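/- Let $0<\alpha\le 2$, $0<H<1$ and $d\in\mathbb N$. Let $X=\{X(t),t\ge 0\}$ be a $d$-dimensional $\alpha$-time fractional Brownian motion on a probability space $(\Omega,\mathcal F,\mathbb P)$, that is, $X(t)=\big(W_1(Y_1(t)),\dots,W_d(Y_d(t))\big)$ where: * $W_1,\dots,W_d$ are independent real-valued fractional Brownian motions indexed by $\mathbb R$, i.e. centered Gaussian processes with $\mathbb E[W_j(t)W_j(s)]=\tfrac12\big(|t|^{2H}+|s|^{2H}-|t-s|^{2H}\big)$, $W_j(0)=0$ almost surely, and almost surely continuous paths; * $Y_1,\dots,Y_d$ are independent copies of a real-valued strictly $\alpha$-stable Lévy process: $Y_j(0)=0$ almost surely, $Y_j$ is stochastically continuous with stationary independent increments, and $\mathbb E\,e^{izY_j(t)}=e^{t\psi(z)}$ with $\psi(z)=-\sigma|z|^\alpha\big(1-i\beta\,\mathrm{sgn}(z)\tan\frac{\pi\alpha}2\big)$ for constants $\sigma>0$ and $\beta\in[-1,1]$ that do not depend on $j$; when $\alpha=1$, $\beta=0$ and $\psi(z)=-\sigma|z|$. Moreover $(t,\omega)\mapsto Y_j(t,\omega)$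 is measurable up to null sets (as is automatic if $Y_j$ has almost surely càdlàg paths); * the families $(W_j)_j$ and $(Y_j)_j$ are independent of each other. For $T>0$ let $\mu_{[0,T]}(A)=\lambda_1\{t\in[0,T]:X(t)\in A\}$ be the occupation measure of $X$ on $[0,T]$, where $\lambda_k$ is Lebesgue measure on $\mathbb R^k$. Then for every $T>0$ the following are equivalent: 1. almost surely $\mu_{[0,T]}$ is absolutely continuous with respect to $\lambda_d$, and its Radon–Nikodym derivative, the local time $L(x,T)$, $x\in\mathbb R^d$, has a version, measurable jointly in $(\omega,x)$ up to null sets, with $L(\cdot,T)\in L^2(\mathbb P\times\lambda_d)$; 2. $d<\alpha/H$. -/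

import Mathlib

open MeasureTheory ProbabilityTheory Filter Topology
open scoped NNReal ENNReal

namespace AlphaTime

/-- `W = {W(t), t ∈ ℝ}` is a real-valued (two-sided) fractional Brownian motion with Hurst index
`H` under `P`: a centered Gaussian process with covariance
`E[W(t) W(s)] = (|t|^{2H} + |s|^{2H} - |t - s|^{2H}) / 2`, with `W(0) = 0` almost surely and with
almost surely continuous sample paths. -/
structure IsFractionalBrownianMotion {Ω : Type*} [MeasurableSpace Ω] (H : ℝ) (W : ℝ → Ω → ℝ)
    (P : Measure Ω) : Prop where
  isGaussianProcess : IsGaussianProcess W P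
  centered : ∀ t, ∫ ω, W t ω ∂P = 0
  covariance : ∀ s t, ∫ ω, W t ω * W s ω ∂P =
    (1 / 2 : ℝ) * (|t| ^ (2 * H) + |s| ^ (2 * H) - |t - s| ^ (2 * H))
  zero : ∀ᵐ ω ∂P, W 0 ω = 0
  continuous_paths : ∀ᵐ ω ∂P, Continuous fun t => W t ω

/-- The characteristic exponent
`ψ(z) = -σ |z|^α (1 - i β sgn(z) tan(π α / 2))` of a strictly `α`-stable law. It is used for
`α = 1` only with `β = 0`, where it equals `-σ |z|`. -/
noncomputable def stableExponent (α σ β z : ℝ) : ℂ :=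
  -((σ * |z| ^ α : ℝ) : ℂ) *
    (1 - Complex.I * ((β * (SignType.sign z : ℝ) * Real.tan (Real.pi * α / 2) : ℝ) : ℂ))

/-- `Y = {Y(t), t ≥ 0}` is a real-valued strictly `α`-stable Lévy process starting from `0`, with
scale `σ` and skewness `β`. The convention is `E[exp(i z Y(t))] = exp(t ψ(z))`.
The last field says that the process is measurable (jointly in time and chance, up to null sets),
which is what occupation times need; it is automatic when the paths are almost surely
right-continuous with left limits. -/
structure IsStrictlyStableLevyProcess {Ω : Type*} [MeasurableSpace Ω] (α σ β : ℝ)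
    (Y : ℝ≥0 → Ω → ℝ) (P : Measure Ω) : Prop where
  index_pos : 0 < α
  index_le_two : α ≤ 2
  scale_pos : 0 < σ
  neg_one_le_skewness : -1 ≤ β
  skewness_le_one : β ≤ 1
  strict : α = 1 → β = 0
  aemeasurable : ∀ t, AEMeasurable (Y t) P
  zero : ∀ᵐ ω ∂P, Y 0 ω = 0
  indepIncrements : HasIndepIncrements Y P
  stationaryIncrements : ∀ s h : ℝ≥0,
    IdentDistrib (fun ω => Y (s + h) ω - Y s ω) (fun ω => Y h ω - Y 0 ω) P P
  stochasticallyContinuous : ∀ t, TendstoInMeasure P Y (𝓝 t) (Y t)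
  charFun_eq : ∀ (t : ℝ≥0) (z : ℝ),
    charFun (P.map (Y t)) z = Complex.exp (((t : ℝ) : ℂ) * stableExponent α σ β z)
  measurable_process :
    AEMeasurable (fun p : ℝ × Ω => Y p.1.toNNReal p.2)
      (((volume : Measure ℝ).restrict (Set.Ici 0)).prod P)

/-- `X = {X(t), t ≥ 0}` is a `d`-dimensional `α`-time fractional Brownian motion of Hurst index
`H`: `X(t) = (W₁(Y₁(t)), …, W_d(Y_d(t)))`, where the `W_j` are independent copies of a fractional
Brownian motion of index `H`, the `Y_j` are independent copies of a strictly `α`-stable Lévy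
process, and the two families `(W_j)` and `(Y_j)` are independent of each other. Independence is
that of processes, i.e. of random elements of the path spaces with the product `σ`-algebra. -/
def IsAlphaTimeFractionalBrownianMotion {Ω : Type*} [MeasurableSpace Ω] {d : ℕ} (α H : ℝ)
    (X : ℝ≥0 → Ω → EuclideanSpace ℝ (Fin d)) (P : Measure Ω) : Prop :=
  ∃ (σ β : ℝ) (W : Fin d → ℝ → Ω → ℝ) (Y : Fin d → ℝ≥0 → Ω → ℝ),
    (∀ j, IsFractionalBrownianMotion H (W j) P) ∧
    (∀ j, IsStrictlyStableLevyProcess α σ β (Y j) P) ∧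
    iIndepFun (fun (j : Fin d) (ω : Ω) (t : ℝ) => W j t ω) P ∧
    iIndepFun (fun (j : Fin d) (ω : Ω) (t : ℝ≥0) => Y j t ω) P ∧
    IndepFun (fun (ω : Ω) (j : Fin d) (t : ℝ) => W j t ω)
      (fun (ω : Ω) (j : Fin d) (t : ℝ≥0) => Y j t ω) P ∧
    ∀ t ω j, X t ω j = W j (Y j t ω) ω

/-- The occupation measure `μ_B(A) = λ₁ {t ∈ B : x(t) ∈ A}` of a path `x` on a time set `B`. -/
noncomputable def occupationMeasure {d : ℕ} (x : ℝ → EuclideanSpace ℝ (Fin d)) (B : Set ℝ) :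
    Measure (EuclideanSpace ℝ (Fin d)) :=
  (volume.restrict B).map x

/-- `ℓ` is (a version of) the local time of the path `x` on the time set `B`: the path is
measurable on `B` (up to a Lebesgue-null set of times), its occupation measure on `B` is absolutely
continuous with respect to Lebesgue measure, and `ℓ` is its Radon-Nikodym derivative. -/
structure IsLocalTime {d : ℕ} (x : ℝ → EuclideanSpace ℝ (Fin d)) (B : Set ℝ)
    (ℓ : EuclideanSpace ℝ (Fin d) → ℝ) : Prop where
  aemeasurable_path : AEMeasurable x (volume.restrict B)
  absolutelyContinuous : occupationMeasure x B ≪ volume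
  ae_eq_rnDeriv : ∀ᵐ y, ℓ y = ((occupationMeasure x B).rnDeriv volume y).toReal

end AlphaTime

/-! A finite measure has an L² density exactly when its averages over small balls stay bounded in
L². Squaring an average and applying Tonelli turns its mean squared L² norm into a double time
integral of E K_r(X(t), X(s)), where K_r is the convolution square of the normalized ball indicator
(`lintegral_ballAverage_map_sq`). The question becomes whether an energy integral stays finite as r
→ 0.

With sup-norm balls K_r is a product over coordinates, and by independence so is its expectation
(`lintegral_ballKernel_timeChange`). In one coordinate, given Y, the increment of W is Gaussian with
standard deviation |Y(t) - Y(s)|^H. Hence the mean kernel is at most 2|Y(t) - Y(s)|^(-H), and at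
least a constant times this power once r is below the standard deviation. Self-similarity gives
E|Y(t) - Y(s)|^(-H) = |t - s|^(-H/α) E|Y(1)|^(-H) (`IsStrictlyStableLevyProcess.lintegral_abs_sub`),
and the last moment is finite because Y(1) has an integrable characteristic function and H < 1. The
expectation is thus of order |t - s|^(-Hd/α), which is integrable over [0,T]² iff Hd/α < 1
(`lintegral_lintegral_rpow_neg_lt_top_iff`).

For sufficiency, the upper bound is uniform in r and `exists_density_of_ballAverage_bounded`
produces the density. For necessity, averaging does not increase the L² norm
(`lintegral_ballAverage_map_sq_le`), and Fatou carries the lower bound to the limit r → 0. -/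

namespace AlphaTime

/-! ### Ball averages of a measure and L² densities -/

section BallAverage

/-- The density at `x` of the measure `μ` averaged over balls of radius `r`. -/
noncomputable def ballAverage {E : Type*} [NormedAddCommGroup E] [MeasurableSpace E]
    (lam μ : Measure E) (r : ℝ) (x : E) : ℝ≥0∞ :=
  μ (Metric.closedBall x r) / lam (Metric.closedBall 0 r)

/-- The convolution square of the normalized indicator of a ball of radius `r`. -/
noncomputable def ballKernel {E : Type*} [NormedAddCommGroup E] [MeasurableSpace E]
    (lam : Measure E) (r : ℝ) (a b : E) : ℝ≥0∞ :=
  lam (Metric.closedBall a r ∩ Metric.closedBall b r) / lam (Metric.closedBall 0 r) ^ 2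

/-- The indicator of the relation `dist x y ≤ r`. -/
noncomputable def closeIndicator {E : Type*} [NormedAddCommGroup E] (r : ℝ) (x y : E) : ℝ≥0∞ :=
  (Metric.closedBall x r).indicator 1 y

lemma closeIndicator_comm {E : Type*} [NormedAddCommGroup E] (r : ℝ) (x y : E) :
    closeIndicator r x y = closeIndicator r y x := by
  classical
  simp only [closeIndicator, Set.indicator_apply, Metric.mem_closedBall, dist_comm,
    Pi.one_apply]

lemma measurable_closeIndicator {E : Type*} [NormedAddCommGroup E] [MeasurableSpace E]
    [BorelSpace E] [SecondCountableTopology E] {A : Type*} [MeasurableSpace A] (r : ℝ)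
    {f g : A → E} (hf : Measurable f) (hg : Measurable g) :
    Measurable fun a => closeIndicator r (f a) (g a) := by
  have : MeasurableSet {p : E × E | dist p.2 p.1 ≤ r} :=
    measurableSet_le (measurable_snd.dist measurable_fst) measurable_const
  exact ((measurable_one (α := ℝ≥0∞)).indicator this).comp (hf.prodMk hg)

lemma lintegral_closeIndicator {E : Type*} [NormedAddCommGroup E] [MeasurableSpace E]
    [BorelSpace E] (μ : Measure E) (r : ℝ) (x : E) :
    ∫⁻ y, closeIndicator r x y ∂μ = μ (Metric.closedBall x r) :=
  lintegral_indicator_one Metric.isClosed_closedBall.measurableSet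

variable {E : Type*} [NormedAddCommGroup E] [MeasurableSpace E] [BorelSpace E]
  (lam : Measure E)

lemma ballKernel_eq (r : ℝ) (a b : E) : ballKernel lam r a b =
    (lam (Metric.closedBall 0 r) ^ 2)⁻¹ *
      ∫⁻ x, closeIndicator r x a * closeIndicator r x b ∂lam := by
  rw [ballKernel, ENNReal.div_eq_inv_mul, ← lintegral_indicator_one
    (Metric.isClosed_closedBall.measurableSet.inter Metric.isClosed_closedBall.measurableSet)]
  simp_rw [closeIndicator_comm r _ a, closeIndicator_comm r _ b, Set.inter_indicator_one]
  rfl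

lemma measurable_ballAverage [SecondCountableTopology E] (μ : Measure E) [SFinite μ] (r : ℝ) :
    Measurable (ballAverage lam μ r) := by
  refine Measurable.div_const ?_ _
  simp_rw [← lintegral_closeIndicator]
  exact Measurable.lintegral_prod_right' (f := fun q : E × E => closeIndicator r q.1 q.2)
    (measurable_closeIndicator r (by fun_prop) (by fun_prop))

variable [NormedSpace ℝ E] [FiniteDimensional ℝ E] [lam.IsAddHaarMeasure]

lemma measurable_ballKernel (r : ℝ) :
    Measurable fun p : E × E => ballKernel lam r p.1 p.2 := by
  simp_rw [ballKernel_eq]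
  refine Measurable.const_mul ?_ _
  exact Measurable.lintegral_prod_right' (f := fun q : (E × E) × E =>
    closeIndicator r q.2 q.1.1 * closeIndicator r q.2 q.1.2)
    ((measurable_closeIndicator r (by fun_prop) (by fun_prop)).mul
      (measurable_closeIndicator r (by fun_prop) (by fun_prop)))

/-- The square of μ(B(x,r)) is the μ⊗μ-measure of the pairs lying in B(x,r); Tonelli then integrates
out the centre x. -/
lemma lintegral_ballAverage_sq (μ : Measure E) [SFinite μ] (r : ℝ) :
    ∫⁻ x, ballAverage lam μ r x ^ 2 ∂lam = ∫⁻ a, ∫⁻ b, ballKernel lam r a b ∂μ ∂μ := by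
  have h1 : ∀ x, ballAverage lam μ r x ^ 2 = (lam (Metric.closedBall 0 r) ^ 2)⁻¹ *
      ∫⁻ p : E × E, closeIndicator r x p.1 * closeIndicator r x p.2 ∂μ.prod μ := by
    intro x
    rw [lintegral_prod_mul, lintegral_closeIndicator, ballAverage, ENNReal.div_eq_inv_mul, mul_pow,
      ENNReal.inv_pow, sq (μ _)]
    all_goals exact (measurable_closeIndicator r (by fun_prop) (by fun_prop)).aemeasurable
  have hm : Measurable fun p : E × E × E =>
      closeIndicator r p.1 p.2.1 * closeIndicator r p.1 p.2.2 :=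
    (measurable_closeIndicator r (by fun_prop) (by fun_prop)).mul
      (measurable_closeIndicator r (by fun_prop) (by fun_prop))
  have hm' : Measurable fun p : (E × E) × E =>
      closeIndicator r p.2 p.1.1 * closeIndicator r p.2 p.1.2 :=
    (measurable_closeIndicator r (by fun_prop) (by fun_prop)).mul
      (measurable_closeIndicator r (by fun_prop) (by fun_prop))
  simp_rw [h1]
  rw [lintegral_const_mul _ hm.lintegral_prod_right', lintegral_lintegral_swap hm.aemeasurable,
    ← lintegral_const_mul _ hm'.lintegral_prod_right']
  simp_rw [← ballKernel_eq]
  exact lintegral_prod (fun p : E × E => ballKernel lam r p.1 p.2)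
    (measurable_ballKernel lam r).aemeasurable

lemma setLIntegral_ballAverage (μ : Measure E) [SFinite μ] (r : ℝ) (U : Set E) :
    ∫⁻ x in U, ballAverage lam μ r x ∂lam =
      ∫⁻ y, lam.restrict U (Metric.closedBall y r) / lam (Metric.closedBall 0 r) ∂μ := by
  have hm : Measurable fun p : E × E => closeIndicator r p.1 p.2 :=
    measurable_closeIndicator r (by fun_prop) (by fun_prop)
  have hm' : Measurable fun p : E × E => closeIndicator r p.2 p.1 :=
    measurable_closeIndicator r (by fun_prop) (by fun_prop)
  simp_rw [ballAverage, ENNReal.div_eq_inv_mul, ← lintegral_closeIndicator (μ := μ)]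
  rw [lintegral_const_mul _ hm.lintegral_prod_right', lintegral_lintegral_swap hm.aemeasurable,
    ← lintegral_const_mul _ hm'.lintegral_prod_right']
  simp_rw [← lintegral_closeIndicator (μ := lam.restrict U), closeIndicator_comm r]

/-- By Tonelli the right side integrates over y the fraction of the ball around y that lies in U.
For y in U this fraction is eventually 1, so Fatou applies. -/
lemma measure_isOpen_le_liminf (μ : Measure E) [IsFiniteMeasure μ] {r : ℕ → ℝ}
    (hr : ∀ n, 0 < r n) (hr0 : Tendsto r atTop (𝓝 0)) {U : Set E} (hU : IsOpen U) :
    μ U ≤ liminf (fun n => ∫⁻ x in U, ballAverage lam μ (r n) x ∂lam) atTop := by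
  simp_rw [setLIntegral_ballAverage]
  refine le_trans ?_ (lintegral_liminf_le fun n => ?_)
  · rw [← lintegral_indicator_one hU.measurableSet]
    refine lintegral_mono fun y => ?_
    by_cases hy : y ∈ U
    · rw [Set.indicator_of_mem hy]
      obtain ⟨ε, hε, hεU⟩ := Metric.isOpen_iff.1 hU y hy
      refine le_liminf_of_le (by isBoundedDefault) ?_
      filter_upwards [hr0.eventually (gt_mem_nhds hε)] with n hn
      rw [Measure.restrict_apply Metric.isClosed_closedBall.measurableSet,
        Set.inter_eq_left.2 ((Metric.closedBall_subset_ball hn).trans hεU),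
        Measure.addHaar_closedBall_center lam, ENNReal.div_self]
      · rfl
      · exact (Metric.measure_closedBall_pos _ _ (hr n)).ne'
      · exact measure_closedBall_lt_top.ne
    · simp [hy]
  · refine Measurable.div_const ?_ _
    simp_rw [← lintegral_closeIndicator (μ := lam.restrict U)]
    exact Measurable.lintegral_prod_right' (f := fun q : E × E => closeIndicator _ q.1 q.2)
      (measurable_closeIndicator _ (by fun_prop) (by fun_prop))

/-- Cauchy–Schwarz on an open U bounds μ(U) by the square root of C·λ(U), and outer regularity
extends this to null sets. A bound along infinitely many n suffices, which is all that Fatou in ω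
will provide. -/
lemma absolutelyContinuous_of_ballAverage_bounded (μ : Measure E) [IsFiniteMeasure μ] {r : ℕ → ℝ}
    (hr : ∀ n, 0 < r n) (hr0 : Tendsto r atTop (𝓝 0)) {C : ℝ≥0∞} (hC : C ≠ ∞)
    (h : ∃ᶠ n in atTop, ∫⁻ x, ballAverage lam μ (r n) x ^ 2 ∂lam ≤ C) : μ ≪ lam := by
  have key : ∀ U, IsOpen U → μ U ≤ (lam U) ^ (1 / 2 : ℝ) * C ^ (1 / 2 : ℝ) := by
    intro U hU
    refine (measure_isOpen_le_liminf lam μ hr hr0 hU).trans ?_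
    refine liminf_le_of_frequently_le' (h.mono fun n hn => ?_)
    have := ENNReal.lintegral_mul_le_Lp_mul_Lq (lam.restrict U) Real.HolderConjugate.two_two
      (f := 1) (g := ballAverage lam μ (r n)) aemeasurable_const
      (measurable_ballAverage lam μ (r n)).aemeasurable
    simp only [one_mul, Pi.one_apply, one_pow, lintegral_one, Measure.restrict_apply_univ,
      ENNReal.rpow_two] at this
    refine this.trans ?_
    gcongr
    exact (setLIntegral_le_lintegral _ _).trans hn
  intro A hA
  by_contra hne
  have hlim : Tendsto (fun ε : ℝ≥0∞ => ε ^ (1 / 2 : ℝ) * C ^ (1 / 2 : ℝ)) (𝓝 0) (𝓝 0) := by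
    have : Tendsto (fun ε : ℝ≥0∞ => ε ^ (1 / 2 : ℝ) * C ^ (1 / 2 : ℝ)) (𝓝 0)
        (𝓝 ((0 : ℝ≥0∞) ^ (1 / 2 : ℝ) * C ^ (1 / 2 : ℝ))) :=
      ENNReal.Tendsto.mul_const ((ENNReal.continuous_rpow_const).tendsto 0)
        (Or.inr (ENNReal.rpow_ne_top_of_nonneg (by norm_num) hC))
    simpa using this
  have hev := hlim.eventually (gt_mem_nhds (pos_iff_ne_zero.2 hne))
  obtain ⟨ε, hε, hε0⟩ := (hev.filter_mono nhdsWithin_le_nhds |>.and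
    (self_mem_nhdsWithin (s := Set.Ioi (0 : ℝ≥0∞)))).exists
  obtain ⟨U, hAU, hU, hUε⟩ := A.exists_isOpen_lt_of_lt (μ := lam) ε (by rw [hA]; exact hε0)
  have := ((measure_mono hAU).trans (key U hU)).trans_lt
    ((mul_le_mul_left (ENNReal.rpow_le_rpow hUε.le (by norm_num)) _).trans_lt hε)
  exact lt_irrefl _ this

lemma tendsto_ballAverage (μ : Measure E) [IsFiniteMeasure μ] {r : ℕ → ℝ}
    (hr : ∀ n, 0 < r n) (hr0 : Tendsto r atTop (𝓝 0)) :
    ∀ᵐ x ∂lam, Tendsto (fun n => ballAverage lam μ (r n) x) atTop (𝓝 (μ.rnDeriv lam x)) := by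
  filter_upwards [Besicovitch.ae_tendsto_rnDeriv μ lam] with x hx
  simp_rw [Measure.addHaar_closedBall_center lam] at hx
  exact hx.comp (tendsto_nhdsWithin_iff.2 ⟨hr0, Eventually.of_forall hr⟩)

/-- Averaging contracts L²: Cauchy–Schwarz on each ball, then Tonelli. -/
lemma lintegral_ballAverage_withDensity_sq_le {f : E → ℝ≥0∞} (hf : Measurable f) {r : ℝ}
    (hr : 0 < r) :
    ∫⁻ x, ballAverage lam (lam.withDensity f) r x ^ 2 ∂lam ≤ ∫⁻ x, f x ^ 2 ∂lam := by
  set V := lam (Metric.closedBall (0 : E) r) with hV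
  have hV0 : V ≠ 0 := (Metric.measure_closedBall_pos _ _ hr).ne'
  have hVt : V ≠ ∞ := measure_closedBall_lt_top.ne
  have h1 : ∀ x, ballAverage lam (lam.withDensity f) r x ^ 2 ≤
      V⁻¹ * ∫⁻ y, closeIndicator r x y * f y ^ 2 ∂lam := by
    intro x
    have := ENNReal.lintegral_mul_le_Lp_mul_Lq (lam.restrict (Metric.closedBall x r))
      Real.HolderConjugate.two_two (f := 1) (g := f) aemeasurable_const hf.aemeasurable
    simp only [one_mul, Pi.one_apply, one_pow, lintegral_one, Measure.restrict_apply_univ,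
      ENNReal.rpow_two, Measure.addHaar_closedBall_center] at this
    rw [← hV] at this
    have h2 : (∫⁻ y in Metric.closedBall x r, f y ∂lam) ^ 2 ≤
        V * ∫⁻ y in Metric.closedBall x r, f y ^ 2 ∂lam := by
      refine (pow_le_pow_left' this 2).trans_eq ?_
      rw [mul_pow, ← ENNReal.rpow_two, ← ENNReal.rpow_two, ← ENNReal.rpow_mul, ← ENNReal.rpow_mul]
      norm_num
    have h3 : ∫⁻ y, closeIndicator r x y * f y ^ 2 ∂lam =
        ∫⁻ y in Metric.closedBall x r, f y ^ 2 ∂lam := by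
      rw [← lintegral_indicator Metric.isClosed_closedBall.measurableSet]
      refine lintegral_congr fun y => ?_
      by_cases hy : y ∈ Metric.closedBall x r <;> simp only [closeIndicator, hy,
        Set.indicator_of_mem, Set.indicator_of_notMem, not_false_eq_true, Pi.one_apply, one_mul,
        zero_mul]
    rw [ballAverage, withDensity_apply _ Metric.isClosed_closedBall.measurableSet, h3, ← hV,
      ENNReal.div_eq_inv_mul, mul_pow]
    calc (V⁻¹) ^ 2 * (∫⁻ y in Metric.closedBall x r, f y ∂lam) ^ 2
        ≤ (V⁻¹) ^ 2 * (V * ∫⁻ y in Metric.closedBall x r, f y ^ 2 ∂lam) := by gcongr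
      _ = V⁻¹ * (V⁻¹ * V) * ∫⁻ y in Metric.closedBall x r, f y ^ 2 ∂lam := by ring
      _ = _ := by rw [ENNReal.inv_mul_cancel hV0 hVt, mul_one]
  refine (lintegral_mono h1).trans ?_
  have hm : Measurable fun p : E × E => closeIndicator r p.1 p.2 * f p.2 ^ 2 :=
    (measurable_closeIndicator r (by fun_prop) (by fun_prop)).mul
      ((hf.comp measurable_snd).pow_const 2)
  rw [lintegral_const_mul _ hm.lintegral_prod_right', lintegral_lintegral_swap hm.aemeasurable]
  have h4 : ∀ y, ∫⁻ x, closeIndicator r x y * f y ^ 2 ∂lam = V * f y ^ 2 := by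
    intro y
    simp_rw [closeIndicator_comm r _ y]
    rw [lintegral_mul_const, lintegral_closeIndicator, Measure.addHaar_closedBall_center lam]
    exact measurable_closeIndicator r (by fun_prop) (by fun_prop)
  simp_rw [h4]
  rw [lintegral_const_mul _ (hf.pow_const 2), ← mul_assoc, ENNReal.inv_mul_cancel hV0 hVt, one_mul]

end BallAverage

/-! ### Ball averages of random occupation measures -/

section RandomOccupation

variable {E : Type*} [NormedAddCommGroup E] [MeasurableSpace E] [BorelSpace E]
  (lam : Measure E)
  {Ω A : Type*} [MeasurableSpace Ω] [MeasurableSpace A] (P : Measure Ω)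
  (ν : Measure A) {Z : A × Ω → E}

lemma measurable_ballAverage_map [SecondCountableTopology E] [SFinite ν]
    (hZ : Measurable Z) (r : ℝ) :
    Measurable fun p : Ω × E => ballAverage lam (ν.map fun t => Z (t, p.1)) r p.2 := by
  refine Measurable.div_const ?_ _
  have h : ∀ p : Ω × E, (ν.map fun t => Z (t, p.1)) (Metric.closedBall p.2 r) =
      ∫⁻ t, closeIndicator r p.2 (Z (t, p.1)) ∂ν := fun p => by
    rw [← lintegral_closeIndicator, lintegral_map]
    · exact measurable_closeIndicator r (by fun_prop) (by fun_prop)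
    · fun_prop
  simp_rw [h]
  exact Measurable.lintegral_prod_right' (f := fun q : (Ω × E) × A =>
    closeIndicator r q.1.2 (Z (q.2, q.1.1)))
    (measurable_closeIndicator r (by fun_prop) (by fun_prop))

variable [NormedSpace ℝ E] [FiniteDimensional ℝ E] [lam.IsAddHaarMeasure]

lemma lintegral_lintegral_prod_comm [SFinite P] [SFinite ν]
    {F : A → A → Ω → ℝ≥0∞}
    (hF : Measurable fun q : (A × A) × Ω => F q.1.1 q.1.2 q.2) :
    ∫⁻ ω, ∫⁻ t, ∫⁻ s, F t s ω ∂ν ∂ν ∂P = ∫⁻ t, ∫⁻ s, ∫⁻ ω, F t s ω ∂P ∂ν ∂ν := by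
  have h1 : ∀ ω, ∫⁻ t, ∫⁻ s, F t s ω ∂ν ∂ν = ∫⁻ p : A × A, F p.1 p.2 ω ∂ν.prod ν := fun ω =>
    (lintegral_prod (fun p : A × A => F p.1 p.2 ω)
      (hF.comp (measurable_prodMk_right (y := ω))).aemeasurable).symm
  simp_rw [h1]
  rw [lintegral_lintegral_swap (f := fun ω (p : A × A) => F p.1 p.2 ω)
    (hF.comp measurable_swap).aemeasurable]
  exact lintegral_prod (fun p : A × A => ∫⁻ ω, F p.1 p.2 ω ∂P)
    hF.lintegral_prod_right'.aemeasurable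

lemma lintegral_ballAverage_map_sq [SFinite P] [SFinite ν] (hZ : Measurable Z) (r : ℝ) :
    ∫⁻ ω, ∫⁻ x, ballAverage lam (ν.map fun t => Z (t, ω)) r x ^ 2 ∂lam ∂P =
      ∫⁻ t, ∫⁻ s, ∫⁻ ω, ballKernel lam r (Z (t, ω)) (Z (s, ω)) ∂P ∂ν ∂ν := by
  have hK := measurable_ballKernel lam r
  have h1 : ∀ ω, ∫⁻ x, ballAverage lam (ν.map fun t => Z (t, ω)) r x ^ 2 ∂lam =
      ∫⁻ t, ∫⁻ s, ballKernel lam r (Z (t, ω)) (Z (s, ω)) ∂ν ∂ν := by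
    intro ω
    have hZω : Measurable fun t => Z (t, ω) := hZ.comp measurable_prodMk_right
    rw [lintegral_ballAverage_sq, lintegral_map hK.lintegral_prod_right' hZω]
    refine lintegral_congr fun a => ?_
    exact lintegral_map (hK.comp measurable_prodMk_left) hZω
  simp_rw [h1]
  exact lintegral_lintegral_prod_comm P ν (F := fun t s ω => ballKernel lam r (Z (t, ω)) (Z (s, ω)))
    (hK.comp ((hZ.comp (by fun_prop : Measurable fun q : (A × A) × Ω => (q.1.1, q.2))).prodMk
      (hZ.comp (by fun_prop : Measurable fun q : (A × A) × Ω => (q.1.2, q.2)))))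

lemma measurable_lintegral_ballKernel [SFinite P] (hZ : Measurable Z) (r : ℝ) :
    Measurable fun p : A × A => ∫⁻ ω, ballKernel lam r (Z (p.1, ω)) (Z (p.2, ω)) ∂P :=
  Measurable.lintegral_prod_right' (f := fun q : (A × A) × Ω =>
    ballKernel lam r (Z (q.1.1, q.2)) (Z (q.1.2, q.2)))
    ((measurable_ballKernel lam r).comp
      ((hZ.comp (by fun_prop : Measurable fun q : (A × A) × Ω => (q.1.1, q.2))).prodMk
        (hZ.comp (by fun_prop : Measurable fun q : (A × A) × Ω => (q.1.2, q.2)))))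

/-- If the averaged densities are bounded in `L²`, then almost every occupation measure is
absolutely continuous and its density is jointly measurable and square integrable. -/
lemma exists_density_of_ballAverage_bounded [IsFiniteMeasure ν] (hZ : Measurable Z) {r : ℕ → ℝ}
    (hr : ∀ n, 0 < r n) (hr0 : Tendsto r atTop (𝓝 0)) {C : ℝ≥0∞} (hC : C ≠ ∞)
    (h : ∀ n, ∫⁻ ω, ∫⁻ x, ballAverage lam (ν.map fun t => Z (t, ω)) (r n) x ^ 2 ∂lam ∂P ≤ C) :
    ∃ g : Ω × E → ℝ≥0∞, Measurable g ∧ ∫⁻ ω, ∫⁻ x, g (ω, x) ^ 2 ∂lam ∂P ≤ C ∧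
      ∀ᵐ ω ∂P, (ν.map fun t => Z (t, ω)) = lam.withDensity fun x => g (ω, x) := by
  have hm := fun n => measurable_ballAverage_map lam ν hZ (r n)
  have hm2 : ∀ n, Measurable fun ω =>
      ∫⁻ x, ballAverage lam (ν.map fun t => Z (t, ω)) (r n) x ^ 2 ∂lam :=
    fun n => ((hm n).pow_const 2).lintegral_prod_right'
  -- Only the liminf of the squared norms is controlled for a given ω; the good radii depend on ω.
  have hfatou : ∫⁻ ω, liminf (fun n =>
      ∫⁻ x, ballAverage lam (ν.map fun t => Z (t, ω)) (r n) x ^ 2 ∂lam) atTop ∂P ≤ C :=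
    (lintegral_liminf_le hm2).trans (liminf_le_of_frequently_le' (Frequently.of_forall h))
  have hfin := ae_lt_top (Measurable.liminf hm2) (hfatou.trans_lt hC.lt_top).ne
  have hlim : ∀ ω, ∀ᵐ x ∂lam, limsup (fun n =>
      ballAverage lam (ν.map fun t => Z (t, ω)) (r n) x) atTop =
        (ν.map fun t => Z (t, ω)).rnDeriv lam x := fun ω => by
    filter_upwards [tendsto_ballAverage lam (ν.map fun t => Z (t, ω)) hr hr0] with x hx
    exact hx.limsup_eq
  -- The limsup of averages is jointly measurable in (ω, x), and by differentiation of measures it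
  -- agrees almost everywhere in x with the Radon–Nikodym derivative for each ω.
  refine ⟨fun p => limsup (fun n => ballAverage lam (ν.map fun t => Z (t, p.1)) (r n) p.2) atTop,
    Measurable.limsup hm, ?_, ?_⟩
  · refine (lintegral_mono fun ω => ?_).trans hfatou
    refine le_trans (le_of_eq (lintegral_congr_ae ?_)) (lintegral_liminf_le fun n =>
      ((hm n).comp (measurable_prodMk_left (x := ω))).pow_const 2)
    filter_upwards [tendsto_ballAverage lam (ν.map fun t => Z (t, ω)) hr hr0] with x hx
    have h2 : Tendsto (fun n => ballAverage lam (ν.map fun t => Z (t, ω)) (r n) x ^ 2) atTop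
        (𝓝 (((ν.map fun t => Z (t, ω)).rnDeriv lam x) ^ 2)) :=
      ((ENNReal.continuous_pow 2).tendsto _).comp hx
    rw [hx.limsup_eq]
    exact h2.liminf_eq.symm
  · filter_upwards [hfin] with ω hω
    have hac : (ν.map fun t => Z (t, ω)) ≪ lam := by
      obtain ⟨C', hC', hC't⟩ := exists_between hω
      exact absolutelyContinuous_of_ballAverage_bounded lam _ hr hr0 hC't.ne
        ((frequently_lt_of_liminf_lt (by isBoundedDefault) hC').mono fun n hn => hn.le)
    rw [withDensity_congr_ae (hlim ω), Measure.withDensity_rnDeriv_eq _ _ hac]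

/-- If almost every occupation measure has a density, then the averaged densities are bounded in
`L²` by the density. -/
lemma lintegral_ballAverage_map_sq_le {g : Ω → E → ℝ≥0∞}
    (hg : ∀ᵐ ω ∂P, AEMeasurable (g ω) lam)
    (h : ∀ᵐ ω ∂P, (ν.map fun t => Z (t, ω)) = lam.withDensity (g ω)) {r : ℝ} (hr : 0 < r) :
    ∫⁻ ω, ∫⁻ x, ballAverage lam (ν.map fun t => Z (t, ω)) r x ^ 2 ∂lam ∂P ≤
      ∫⁻ ω, ∫⁻ x, g ω x ^ 2 ∂lam ∂P := by
  refine lintegral_mono_ae ?_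
  filter_upwards [hg, h] with ω hgω hω
  rw [hω, withDensity_congr_ae hgω.ae_eq_mk]
  refine (lintegral_ballAverage_withDensity_sq_le lam hgω.measurable_mk hr).trans_eq ?_
  refine lintegral_congr_ae ?_
  filter_upwards [hgω.ae_eq_mk] with x hx
  rw [hx]

end RandomOccupation

/-! ### Bounds for the kernel and for Gaussian small balls -/

section KernelBounds

/-- On `ι → ℝ` the norm is the sup norm, so balls and their intersections are boxes. -/
lemma ballKernel_pi {ι : Type*} [Fintype ι] {r : ℝ} (hr : 0 < r) (a b : ι → ℝ) :
    ballKernel (volume : Measure (ι → ℝ)) r a b =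
      ∏ j, ballKernel (volume : Measure ℝ) r (a j) (b j) := by
  simp only [ballKernel]
  rw [closedBall_pi _ hr.le, closedBall_pi _ hr.le, closedBall_pi _ hr.le, ← Set.pi_inter_distrib,
    volume_pi_pi, volume_pi_pi, ← Finset.prod_pow]
  simp only [ENNReal.div_eq_inv_mul, Finset.prod_mul_distrib, Pi.zero_apply]
  rw [ENNReal.prod_inv_distrib]
  intro i _ j _ _
  right
  simp [Real.volume_closedBall, ENNReal.mul_eq_top]

lemma closedBall_inter_closedBall_real (r a b : ℝ) :
    volume (Metric.closedBall a r ∩ Metric.closedBall b r) = ENNReal.ofReal (2 * r - |a - b|) := by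
  rw [Real.closedBall_eq_Icc, Real.closedBall_eq_Icc, Set.Icc_inter_Icc, Real.volume_Icc]
  congr 1
  rcases le_total a b with h | h
  · rw [abs_of_nonpos (by linarith), min_eq_left (by linarith), max_eq_right (by linarith)]; ring
  · rw [abs_of_nonneg (by linarith), min_eq_right (by linarith), max_eq_left (by linarith)]; ring

lemma ballKernel_real {r : ℝ} (hr : 0 < r) (a b : ℝ) :
    ballKernel (volume : Measure ℝ) r a b = ENNReal.ofReal ((2 * r - |a - b|) / (2 * r) ^ 2) := by
  rw [ballKernel, closedBall_inter_closedBall_real, Real.volume_closedBall,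
    ← ENNReal.ofReal_pow (by positivity), ENNReal.ofReal_div_of_pos (by positivity)]

lemma ballKernel_real_le {r : ℝ} (hr : 0 < r) (a b : ℝ) :
    ballKernel (volume : Measure ℝ) r a b ≤
      ENNReal.ofReal (1 / (2 * r)) * (Metric.closedBall (0 : ℝ) (2 * r)).indicator 1 (a - b) := by
  rw [ballKernel_real hr]
  by_cases h : a - b ∈ Metric.closedBall (0 : ℝ) (2 * r)
  · rw [Set.indicator_of_mem h, Pi.one_apply, mul_one]
    apply ENNReal.ofReal_le_ofReal
    rw [div_le_div_iff₀ (by positivity) (by positivity)]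
    nlinarith [abs_nonneg (a - b)]
  · rw [Set.indicator_of_notMem h, mul_zero, nonpos_iff_eq_zero, ENNReal.ofReal_eq_zero]
    rw [mem_closedBall_zero_iff, Real.norm_eq_abs, not_le] at h
    exact div_nonpos_of_nonpos_of_nonneg (by linarith) (by positivity)

/-- Two intervals of radius r with centres at distance at most r overlap in length at least r, and r
/ (2r)² = 1 / (4r). -/
lemma le_ballKernel_real {r : ℝ} (hr : 0 < r) (a b : ℝ) :
    ENNReal.ofReal (1 / (4 * r)) * (Metric.closedBall (0 : ℝ) r).indicator 1 (a - b) ≤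
      ballKernel (volume : Measure ℝ) r a b := by
  rw [ballKernel_real hr]
  by_cases h : a - b ∈ Metric.closedBall (0 : ℝ) r
  · rw [Set.indicator_of_mem h, Pi.one_apply, mul_one]
    apply ENNReal.ofReal_le_ofReal
    rw [mem_closedBall_zero_iff, Real.norm_eq_abs] at h
    rw [div_le_div_iff₀ (by positivity) (by positivity)]
    nlinarith
  · simp [Set.indicator_of_notMem h]

lemma gaussianReal_closedBall_le {v : ℝ≥0} (hv : v ≠ 0) (s : ℝ) :
    gaussianReal 0 v (Metric.closedBall 0 s) ≤ ENNReal.ofReal (2 * s * (√v)⁻¹) := by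
  have hv0 : (0 : ℝ) < v := by positivity
  rw [gaussianReal_apply _ hv]
  have h : ∀ x, gaussianPDF 0 v x ≤ ENNReal.ofReal (√v)⁻¹ := by
    intro x
    refine ENNReal.ofReal_le_ofReal ?_
    rw [gaussianPDFReal]
    have h1 : Real.exp (-(x - 0) ^ 2 / (2 * v)) ≤ 1 := by
      rw [Real.exp_le_one_iff]
      exact div_nonpos_of_nonpos_of_nonneg (by nlinarith [sq_nonneg (x - 0)]) (by positivity)
    have h2 : (√(2 * Real.pi * v))⁻¹ ≤ (√v)⁻¹ := by
      apply inv_anti₀ (by positivity)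
      apply Real.sqrt_le_sqrt
      nlinarith [Real.pi_gt_three]
    calc _ ≤ (√(2 * Real.pi * v))⁻¹ * 1 := by gcongr
      _ ≤ _ := by rwa [mul_one]
  refine (lintegral_mono h).trans_eq ?_
  rw [lintegral_const, Measure.restrict_apply_univ, Real.volume_closedBall,
    ← ENNReal.ofReal_mul (by positivity), mul_comm]

lemma le_gaussianReal_closedBall {v : ℝ≥0} (hv : v ≠ 0) {r : ℝ} (hrv : r ^ 2 ≤ v) :
    ENNReal.ofReal (2 * r * ((√(2 * Real.pi))⁻¹ * Real.exp (-1 / 2) * (√v)⁻¹)) ≤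
      gaussianReal 0 v (Metric.closedBall 0 r) := by
  have hv0 : (0 : ℝ) < v := by positivity
  rw [gaussianReal_apply _ hv]
  have h : ∀ x ∈ Metric.closedBall (0 : ℝ) r,
      ENNReal.ofReal ((√(2 * Real.pi))⁻¹ * Real.exp (-1 / 2) * (√v)⁻¹) ≤ gaussianPDF 0 v x := by
    intro x hx
    rw [mem_closedBall_zero_iff, Real.norm_eq_abs] at hx
    refine ENNReal.ofReal_le_ofReal ?_
    rw [gaussianPDFReal, Real.sqrt_mul (show 0 ≤ 2 * Real.pi by positivity), mul_inv, mul_right_comm]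
    have : x ^ 2 ≤ r ^ 2 := sq_le_sq' (abs_le.1 hx).1 (abs_le.1 hx).2
    have h1 : -1 / 2 ≤ -(x - 0) ^ 2 / (2 * (v : ℝ)) := by
      rw [div_le_div_iff₀ (by positivity) (by positivity)]
      nlinarith
    gcongr
  refine le_trans (le_of_eq ?_) (setLIntegral_mono' Metric.isClosed_closedBall.measurableSet h)
  rw [lintegral_const, Measure.restrict_apply_univ, Real.volume_closedBall,
    ← ENNReal.ofReal_mul (by positivity), mul_comm]

end KernelBounds

/-! ### Mean kernel of fractional Brownian motion -/

section FractionalBrownianMotion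

variable {Ω : Type*} [MeasurableSpace Ω] {P : Measure Ω} {H : ℝ} {W : ℝ → Ω → ℝ}

lemma IsFractionalBrownianMotion.map_sub (hW : IsFractionalBrownianMotion H W P) (hH : 0 < H)
    (s t : ℝ) :
    P.map (fun ω => W s ω - W t ω) = gaussianReal 0 (|s - t| ^ (2 * H)).toNNReal := by
  have hG := hW.isGaussianProcess
  have hL : HasGaussianLaw (fun ω => W s ω - W t ω) P := hG.hasGaussianLaw_fun_sub
  have hPm : IsProbabilityMeasure P := hG.isProbabilityMeasure
  have h2 : ∀ u, MemLp (W u) 2 P := fun u => (hG.hasGaussianLaw_eval u).memLp_two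
  have hi : ∀ u, Integrable (W u) P := fun u => (hG.hasGaussianLaw_eval u).integrable
  have hmean : ∫ ω, (W s ω - W t ω) ∂P = 0 := by
    rw [integral_sub (hi s) (hi t), hW.centered, hW.centered, sub_zero]
  rw [hL.map_eq_gaussianReal, hmean, variance_of_integral_eq_zero hL.aemeasurable hmean]
  congr 2
  have hii : ∀ a b, Integrable (fun ω => W a ω * W b ω) P := fun a b => (h2 a).integrable_mul (h2 b)
  have h3 : ∀ ω, (W s ω - W t ω) ^ 2 =
      W s ω * W s ω - (2 * (W s ω * W t ω)) + W t ω * W t ω := fun ω => by ring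
  simp_rw [h3]
  have hsub : Integrable (fun ω => W s ω * W s ω - 2 * (W s ω * W t ω)) P :=
    (hii s s).sub ((hii s t).const_mul 2)
  rw [integral_add hsub (hii t t),
    integral_sub (hii s s) ((hii s t).const_mul 2), integral_const_mul]
  have hc := hW.covariance
  rw [hc s s, hc t t, hc t s, sub_self, sub_self, abs_zero, Real.zero_rpow (by positivity)]
  ring

/-- The mean of the kernel at the increment of a fractional Brownian motion. -/
noncomputable def meanKernel (P : Measure Ω) (W : ℝ → Ω → ℝ) (r s t : ℝ) : ℝ≥0∞ :=
  ∫⁻ ω, ballKernel (volume : Measure ℝ) r (W s ω) (W t ω) ∂P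

lemma sqrt_rpow_two_mul_inv {x : ℝ} (hx : 0 < x) (H : ℝ) :
    ENNReal.ofReal (√((x ^ (2 * H)).toNNReal : ℝ))⁻¹ = ENNReal.ofReal x ^ (-H) := by
  rw [Real.coe_toNNReal _ (by positivity), Real.sqrt_eq_rpow, ← Real.rpow_mul hx.le,
    ← Real.rpow_neg hx.le, ENNReal.ofReal_rpow_of_pos hx]
  congr 2; ring

lemma IsFractionalBrownianMotion.lintegral_indicator_sub (hW : IsFractionalBrownianMotion H W P)
    (hH : 0 < H) (s t r : ℝ) :
    ∫⁻ ω, (Metric.closedBall (0 : ℝ) r).indicator 1 (W s ω - W t ω) ∂P =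
      gaussianReal 0 (|s - t| ^ (2 * H)).toNNReal (Metric.closedBall 0 r) := by
  have hm := Metric.isClosed_closedBall.measurableSet (s := Metric.closedBall (0 : ℝ) r)
  rw [← hW.map_sub hH, ← lintegral_indicator_one hm, lintegral_map'
    (measurable_one.indicator hm).aemeasurable hW.isGaussianProcess.hasGaussianLaw_fun_sub.aemeasurable]

lemma IsFractionalBrownianMotion.meanKernel_le (hW : IsFractionalBrownianMotion H W P) (hH : 0 < H)
    {r : ℝ} (hr : 0 < r) (s t : ℝ) :
    meanKernel P W r s t ≤ 2 * ENNReal.ofReal |s - t| ^ (-H) := by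
  -- On the diagonal the bound is vacuous, since `0 ^ (-H) = ∞` in `ℝ≥0∞`.
  rcases eq_or_ne s t with rfl | hst
  · simp [hH]
  have hx : 0 < |s - t| := abs_pos.2 (sub_ne_zero.2 hst)
  have hv : (|s - t| ^ (2 * H)).toNNReal ≠ 0 := by
    rw [ne_eq, Real.toNNReal_eq_zero, not_le]; positivity
  calc meanKernel P W r s t
      ≤ ∫⁻ ω, ENNReal.ofReal (1 / (2 * r)) *
        (Metric.closedBall (0 : ℝ) (2 * r)).indicator 1 (W s ω - W t ω) ∂P :=
        lintegral_mono fun ω => ballKernel_real_le hr _ _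
    _ = ENNReal.ofReal (1 / (2 * r)) * gaussianReal 0 (|s - t| ^ (2 * H)).toNNReal
        (Metric.closedBall 0 (2 * r)) := by
        rw [lintegral_const_mul' _ _ ENNReal.ofReal_ne_top, hW.lintegral_indicator_sub hH]
    _ ≤ ENNReal.ofReal (1 / (2 * r)) *
        ENNReal.ofReal (2 * (2 * r) * (√((|s - t| ^ (2 * H)).toNNReal : ℝ))⁻¹) := by
        gcongr; exact gaussianReal_closedBall_le hv _
    _ = 2 * ENNReal.ofReal |s - t| ^ (-H) := by
        rw [← sqrt_rpow_two_mul_inv hx, ← ENNReal.ofReal_mul (by positivity),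
          show (2 : ℝ≥0∞) = ENNReal.ofReal 2 by simp, ← ENNReal.ofReal_mul (by positivity)]
        congr 1
        field_simp

lemma IsFractionalBrownianMotion.exists_le_meanKernel (P : Measure Ω) (hH : 0 < H) :
    ∃ c : ℝ≥0∞, c ≠ 0 ∧ c ≠ ∞ ∧ ∀ {W : ℝ → Ω → ℝ}, IsFractionalBrownianMotion H W P →
      ∀ {r s t : ℝ}, 0 < r → r ≤ |s - t| ^ H → s ≠ t →
      c * ENNReal.ofReal |s - t| ^ (-H) ≤ meanKernel P W r s t := by
  -- The factor 1/2 is 2r / (4r), and the rest is the standard normal density at 1: r is at most one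
  -- standard deviation.
  refine ⟨ENNReal.ofReal (1 / 2 * ((√(2 * Real.pi))⁻¹ * Real.exp (-1 / 2))), ?_,
    ENNReal.ofReal_ne_top, ?_⟩
  · rw [ne_eq, ENNReal.ofReal_eq_zero, not_le]; positivity
  intro W hW r s t hr hrv hst
  have hx : 0 < |s - t| := abs_pos.2 (sub_ne_zero.2 hst)
  have hv : (|s - t| ^ (2 * H)).toNNReal ≠ 0 := by
    rw [ne_eq, Real.toNNReal_eq_zero, not_le]; positivity
  have hrv' : r ^ 2 ≤ ((|s - t| ^ (2 * H)).toNNReal : ℝ) := by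
    rw [Real.coe_toNNReal _ (by positivity), mul_comm 2 H, Real.rpow_mul hx.le, Real.rpow_two]
    gcongr
  calc _ = ENNReal.ofReal (1 / (4 * r)) * ENNReal.ofReal (2 * r * ((√(2 * Real.pi))⁻¹ *
        Real.exp (-1 / 2) * (√((|s - t| ^ (2 * H)).toNNReal : ℝ))⁻¹)) := by
        rw [← sqrt_rpow_two_mul_inv hx, ← ENNReal.ofReal_mul (by positivity),
          ← ENNReal.ofReal_mul (by positivity)]
        congr 1
        field_simp
        ring
    _ ≤ ENNReal.ofReal (1 / (4 * r)) * gaussianReal 0 (|s - t| ^ (2 * H)).toNNReal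
        (Metric.closedBall 0 r) := by
        gcongr; exact le_gaussianReal_closedBall hv hrv'
    _ = ∫⁻ ω, ENNReal.ofReal (1 / (4 * r)) *
        (Metric.closedBall (0 : ℝ) r).indicator 1 (W s ω - W t ω) ∂P := by
        rw [lintegral_const_mul' _ _ ENNReal.ofReal_ne_top, hW.lintegral_indicator_sub hH]
    _ ≤ meanKernel P W r s t := lintegral_mono fun ω => le_ballKernel_real hr _ _

end FractionalBrownianMotion

/-! ### Small balls, scaling and negative moments of stable processes -/

section StableProcess

/-- Parseval against a centered Gaussian of variance r⁻² replaces Fourier inversion: its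
characteristic function is at least e^(-1/2) on the ball of radius r, while its density is at most
r. -/
lemma closedBall_le_of_integrable_charFun (m : Measure ℝ) [IsProbabilityMeasure m]
    (hm : Integrable (charFun m)) {r : ℝ} (hr : 0 < r) :
    m.real (Metric.closedBall 0 r) ≤ Real.exp (1 / 2) * (∫ z, ‖charFun m z‖) * r := by
  set v : ℝ≥0 := ⟨(r ^ 2)⁻¹, by positivity⟩ with hvdef
  have hv : (v : ℝ) = (r ^ 2)⁻¹ := rfl
  have hv0 : v ≠ 0 := by rw [← NNReal.coe_ne_zero, hv]; positivity
  have hswap : ∫ z, charFun m z ∂gaussianReal 0 v = ∫ x, charFun (gaussianReal 0 v) x ∂m := by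
    simp_rw [charFun_apply_real]
    rw [integral_integral_swap]
    · simp_rw [mul_comm]
    · refine Integrable.of_bound (C := 1) ?_ (Eventually.of_forall fun p => ?_)
      · refine Continuous.aestronglyMeasurable ?_
        unfold Function.uncurry
        fun_prop
      · rw [Function.uncurry, ← Complex.ofReal_mul, Complex.norm_exp_ofReal_mul_I]
  have hcf : ∀ x : ℝ, charFun (gaussianReal 0 v) x = ((Real.exp (-(v * x ^ 2 / 2)) : ℝ) : ℂ) := by
    intro x
    rw [charFun_gaussianReal]
    push_cast
    congr 1
    ring
  have hint : Integrable (fun x : ℝ => Real.exp (-(v * x ^ 2 / 2))) m := by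
    refine Integrable.of_bound (C := 1) (by fun_prop) (Eventually.of_forall fun x => ?_)
    rw [Real.norm_of_nonneg (by positivity), Real.exp_le_one_iff]
    have : 0 ≤ (v : ℝ) * x ^ 2 / 2 := by positivity
    linarith
  have hlow : Real.exp (-(1 / 2)) * m.real (Metric.closedBall 0 r) ≤
      ∫ x, Real.exp (-(v * x ^ 2 / 2)) ∂m := by
    calc Real.exp (-(1 / 2)) * m.real (Metric.closedBall 0 r)
        = ∫ x in Metric.closedBall 0 r, Real.exp (-(1 / 2)) ∂m := by
          rw [setIntegral_const, smul_eq_mul, mul_comm]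
      _ ≤ ∫ x in Metric.closedBall 0 r, Real.exp (-(v * x ^ 2 / 2)) ∂m := by
          refine setIntegral_mono_on (by simp) hint.integrableOn
            Metric.isClosed_closedBall.measurableSet fun x hx => ?_
          rw [mem_closedBall_zero_iff, Real.norm_eq_abs] at hx
          rw [Real.exp_le_exp, neg_le_neg_iff, hv]
          have : x ^ 2 ≤ r ^ 2 := sq_le_sq' (abs_le.1 hx).1 (abs_le.1 hx).2
          have h2 : (r ^ 2)⁻¹ * x ^ 2 ≤ 1 := by
            rw [inv_mul_le_iff₀ (by positivity)]; linarith
          linarith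
      _ ≤ _ := setIntegral_le_integral hint (Eventually.of_forall fun x => by positivity)
  have hup : ∫ x, Real.exp (-(v * x ^ 2 / 2)) ∂m ≤ (∫ z, ‖charFun m z‖) * r := by
    have h1 : ((∫ x, Real.exp (-(v * x ^ 2 / 2)) ∂m : ℝ) : ℂ) =
        ∫ z, charFun m z ∂gaussianReal 0 v := by
      rw [hswap, ← integral_complex_ofReal]
      simp_rw [hcf]
    have h2 : ∫ x, Real.exp (-(v * x ^ 2 / 2)) ∂m = ‖∫ z, charFun m z ∂gaussianReal 0 v‖ := by
      rw [← h1, Complex.norm_real, Real.norm_of_nonneg]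
      exact integral_nonneg fun x => by positivity
    rw [h2]
    refine (norm_integral_le_integral_norm _).trans ?_
    rw [integral_gaussianReal_eq_integral_smul hv0, ← integral_mul_const]
    have hpdf : ∀ z, gaussianPDFReal 0 v z ≤ r := by
      intro z
      rw [gaussianPDFReal]
      have h3 : Real.exp (-(z - 0) ^ 2 / (2 * v)) ≤ 1 := by
        rw [Real.exp_le_one_iff]
        exact div_nonpos_of_nonpos_of_nonneg (by nlinarith [sq_nonneg (z - 0)]) (by positivity)
      have h4 : (√(2 * Real.pi * v))⁻¹ ≤ r := by
        rw [← Real.sqrt_inv, Real.sqrt_le_iff]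
        refine ⟨hr.le, ?_⟩
        rw [hv, mul_inv, inv_inv]
        have : (2 * Real.pi)⁻¹ ≤ 1 := inv_le_one_of_one_le₀ (by nlinarith [Real.pi_gt_three])
        nlinarith [sq_nonneg r]
      calc _ ≤ r * 1 := by gcongr
        _ = r := mul_one r
    refine integral_mono_of_nonneg (Eventually.of_forall fun z => ?_) (hm.norm.mul_const r)
      (Eventually.of_forall fun z => ?_)
    · exact smul_nonneg (gaussianPDFReal_nonneg _ _ _) (norm_nonneg _)
    · simp only [smul_eq_mul]
      rw [mul_comm]
      gcongr
      exact hpdf z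
  have := hlow.trans hup
  rw [Real.exp_neg, inv_mul_le_iff₀ (Real.exp_pos _)] at this
  linarith

/-- Layer cake: |x|^(-H) > t forces |x| < t^(-1/H), of mass at most C t^(-1/H), which is integrable
at infinity because H < 1. -/
lemma lintegral_rpow_neg_lt_top (m : Measure ℝ) [IsProbabilityMeasure m] {C : ℝ}
    (hC : ∀ r, 0 < r → m.real (Metric.closedBall 0 r) ≤ C * r) {H : ℝ} (hH : 0 < H) (hH1 : H < 1) :
    ∫⁻ x, ENNReal.ofReal |x| ^ (-H) ∂m < ∞ := by
  -- An atom at 0 must be excluded first: there the power is ∞ in `ℝ≥0∞` but 0 in `ℝ`.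
  have hm0 : m {0} = 0 := by
    have hle : ∀ r, 0 < r → m.real {0} ≤ C * r := fun r hr =>
      (measureReal_mono (by simp [hr.le])).trans (hC r hr)
    have h0 : m.real {0} ≤ 0 := by
      have hlim : Tendsto (fun r : ℝ => C * r) (𝓝[>] 0) (𝓝 0) := by
        have : Tendsto (fun r : ℝ => C * r) (𝓝 0) (𝓝 (C * 0)) := tendsto_id.const_mul C
        rw [mul_zero] at this
        exact this.mono_left nhdsWithin_le_nhds
      exact ge_of_tendsto hlim (eventually_nhdsWithin_of_forall fun r hr => hle r hr)
    exact (measureReal_eq_zero_iff).1 (le_antisymm h0 measureReal_nonneg)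
  have hae : ∀ᵐ x ∂m, x ≠ 0 := measure_eq_zero_iff_ae_notMem.1 hm0
  have h1 : ∫⁻ x, ENNReal.ofReal |x| ^ (-H) ∂m = ∫⁻ x, ENNReal.ofReal (|x| ^ (-H)) ∂m := by
    refine lintegral_congr_ae ?_
    filter_upwards [hae] with x hx
    exact ENNReal.ofReal_rpow_of_pos (abs_pos.2 hx)
  rw [h1, lintegral_eq_lintegral_meas_lt m (Eventually.of_forall fun x => by positivity)
    (by fun_prop), ← Set.Ioc_union_Ioi_eq_Ioi zero_le_one]
  refine (lintegral_union_le _ _ _).trans_lt (ENNReal.add_lt_top.2 ⟨?_, ?_⟩)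
  · calc _ ≤ ∫⁻ t in Set.Ioc (0 : ℝ) 1, 1 := lintegral_mono fun t => prob_le_one
      _ < ∞ := by simp
  · have hb : ∀ t ∈ Set.Ioi (1 : ℝ), m {x | t < |x| ^ (-H)} ≤
        ENNReal.ofReal (C * t ^ (-(1 / H))) := by
      intro t ht
      have ht0 : 0 < t := zero_lt_one.trans ht
      have hr : 0 < t ^ (-(1 / H)) := by positivity
      rw [← ENNReal.ofReal_toReal (measure_ne_top m {x | t < |x| ^ (-H)})]
      refine ENNReal.ofReal_le_ofReal (le_trans ?_ (hC _ hr))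
      refine ENNReal.toReal_mono (measure_ne_top _ _) (measure_mono fun x hx => ?_)
      rw [mem_closedBall_zero_iff, Real.norm_eq_abs]
      rcases eq_or_ne x 0 with rfl | hx0
      · simpa using hr.le
      have hxp : 0 < |x| := abs_pos.2 hx0
      have h2 := Real.rpow_le_rpow_of_nonpos ht0 (le_of_lt hx)
        (show -(1 / H) ≤ 0 by rw [neg_nonpos]; positivity)
      rw [← Real.rpow_mul hxp.le] at h2
      rwa [show -H * -(1 / H) = 1 by field_simp, Real.rpow_one] at h2
    refine (setLIntegral_mono' measurableSet_Ioi hb).trans_lt ?_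
    have hi : IntegrableOn (fun t : ℝ => C * t ^ (-(1 / H))) (Set.Ioi 1) :=
      (integrableOn_Ioi_rpow_of_lt (by rw [neg_lt_neg_iff, lt_div_iff₀ hH]; linarith)
        zero_lt_one).const_mul C
    exact hi.lintegral_lt_top

variable {Ω : Type*} [MeasurableSpace Ω] {P : Measure Ω} {α σ β : ℝ} {Y : ℝ≥0 → Ω → ℝ}

/-- Skewness only contributes a phase, so the decay is that of the symmetric law. -/
lemma norm_exp_stableExponent (α σ β z : ℝ) :
    ‖Complex.exp (stableExponent α σ β z)‖ = Real.exp (-(σ * |z| ^ α)) := by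
  rw [Complex.norm_exp, stableExponent]
  congr 1
  rw [← Complex.ofReal_neg, Complex.re_ofReal_mul, Complex.sub_re, Complex.one_re,
    mul_comm Complex.I, Complex.re_ofReal_mul, Complex.I_re]
  ring

lemma stableExponent_mul {c : ℝ} (hc : 0 < c) (z : ℝ) :
    stableExponent α σ β (c * z) = ((c ^ α : ℝ) : ℂ) * stableExponent α σ β z := by
  rw [stableExponent, stableExponent, abs_mul, abs_of_pos hc, Real.mul_rpow hc.le (abs_nonneg z),
    sign_mul, sign_pos hc, one_mul]
  push_cast
  ring

lemma IsStrictlyStableLevyProcess.integrable_charFun [IsProbabilityMeasure P]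
    (hY : IsStrictlyStableLevyProcess α σ β Y P) :
    Integrable (charFun (P.map (Y 1))) := by
  have hα := hY.index_pos
  have hσ := hY.scale_pos
  have hcf : ∀ z, ‖charFun (P.map (Y 1)) z‖ = Real.exp (-(σ * |z| ^ α)) := by
    intro z
    rw [hY.charFun_eq 1 z, ← norm_exp_stableExponent α σ β z]
    simp
  have h1 : IntegrableOn (fun z : ℝ => Real.exp (-(σ * |z| ^ α))) (Set.Ioi 0) := by
    refine (integrableOn_rpow_mul_exp_neg_mul_rpow (s := 0) (by norm_num) hα hσ).congr_fun
      (fun x hx => ?_) measurableSet_Ioi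
    simp [abs_of_pos (Set.mem_Ioi.1 hx)]
  have h2 : IntegrableOn (fun z : ℝ => Real.exp (-(σ * |z| ^ α))) (Set.Iio 0) := by
    have := (Measure.measurePreserving_neg (volume : Measure ℝ)).integrableOn_comp_preimage
      (Homeomorph.neg ℝ).measurableEmbedding (f := fun z : ℝ => Real.exp (-(σ * |z| ^ α)))
      (s := Set.Ioi 0)
    have h3 := this.2 h1
    simpa [Function.comp_def] using h3
  have h3 : Integrable (fun z : ℝ => Real.exp (-(σ * |z| ^ α))) := by
    rw [← integrableOn_univ, ← Set.Iic_union_Ioi (a := (0 : ℝ))]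
    exact ((integrableOn_Iic_iff_integrableOn_Iio (by simp)).2 h2).union h1
  refine h3.mono measurable_charFun.aestronglyMeasurable (Eventually.of_forall fun z => ?_)
  rw [hcf, Real.norm_of_nonneg (by positivity)]

lemma IsStrictlyStableLevyProcess.map_eq (hY : IsStrictlyStableLevyProcess α σ β Y P)
    [IsProbabilityMeasure P] {t : ℝ≥0} (ht : 0 < t) :
    P.map (Y t) = (P.map (Y 1)).map fun x => (t : ℝ) ^ (1 / α) * x := by
  have hα := hY.index_pos
  have := Measure.isProbabilityMeasure_map (hY.aemeasurable t)
  have := Measure.isProbabilityMeasure_map (hY.aemeasurable 1)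
  have ht' : (0 : ℝ) < t := ht
  apply Measure.ext_of_charFun
  ext z
  rw [charFun_map_mul, hY.charFun_eq, hY.charFun_eq, stableExponent_mul (by positivity),
    ← Real.rpow_mul ht'.le, one_div_mul_cancel hα.ne', Real.rpow_one]
  simp

/-- The moment of order `-H` of a strictly stable process at time `1`. -/
noncomputable def negMoment (P : Measure Ω) (Y : ℝ≥0 → Ω → ℝ) (H : ℝ) : ℝ≥0∞ :=
  ∫⁻ x, ENNReal.ofReal |x| ^ (-H) ∂P.map (Y 1)

variable [IsProbabilityMeasure P] {H : ℝ}

lemma IsStrictlyStableLevyProcess.negMoment_lt_top (hY : IsStrictlyStableLevyProcess α σ β Y P)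
    (hH : 0 < H) (hH1 : H < 1) : negMoment P Y H < ∞ := by
  have := Measure.isProbabilityMeasure_map (hY.aemeasurable 1)
  exact lintegral_rpow_neg_lt_top _
    (fun r hr => closedBall_le_of_integrable_charFun _ hY.integrable_charFun hr) hH hH1

lemma IsStrictlyStableLevyProcess.negMoment_ne_zero (hY : IsStrictlyStableLevyProcess α σ β Y P)
    (hH : 0 < H) : negMoment P Y H ≠ 0 := by
  have := Measure.isProbabilityMeasure_map (hY.aemeasurable 1)
  rw [negMoment, ne_eq, lintegral_eq_zero_iff (by fun_prop)]
  intro h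
  obtain ⟨x, hx⟩ := h.exists
  rw [Pi.zero_apply, ENNReal.rpow_eq_zero_iff] at hx
  rcases hx with ⟨-, hx⟩ | ⟨hx, -⟩
  · linarith
  · exact ENNReal.ofReal_ne_top hx

lemma IsStrictlyStableLevyProcess.map_sub (hY : IsStrictlyStableLevyProcess α σ β Y P)
    {s t : ℝ≥0} (hst : s < t) :
    P.map (fun ω => Y t ω - Y s ω) =
      (P.map (Y 1)).map fun x => ((t - s : ℝ≥0) : ℝ) ^ (1 / α) * x := by
  rw [← hY.map_eq (tsub_pos_of_lt hst)]
  have h := (hY.stationaryIncrements s (t - s)).map_eq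
  rw [add_tsub_cancel_of_le hst.le] at h
  rw [h]
  refine Measure.map_congr ?_
  filter_upwards [hY.zero] with ω hω
  rw [hω, sub_zero]

/-- The increment has the law of |t - s|^(1/α) Y(1), up to sign; this is where H turns into H/α. -/
lemma IsStrictlyStableLevyProcess.lintegral_abs_sub (hY : IsStrictlyStableLevyProcess α σ β Y P)
    {s t : ℝ≥0} (hst : s ≠ t) (H : ℝ) :
    ∫⁻ ω, ENNReal.ofReal |Y t ω - Y s ω| ^ (-H) ∂P =
      ENNReal.ofReal |(t : ℝ) - s| ^ (-(H / α)) * negMoment P Y H := by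
  wlog h : s < t generalizing s t
  · have := this hst.symm (lt_of_le_of_ne (not_lt.1 h) hst.symm)
    simp_rw [abs_sub_comm (Y t _)]
    rw [this, abs_sub_comm]
  have hm : Measurable fun x : ℝ => ENNReal.ofReal |x| ^ (-H) := by fun_prop
  have h1 : ∫⁻ ω, ENNReal.ofReal |Y t ω - Y s ω| ^ (-H) ∂P =
      ∫⁻ x, ENNReal.ofReal |x| ^ (-H) ∂(P.map fun ω => Y t ω - Y s ω) :=
    (lintegral_map' hm.aemeasurable ((hY.aemeasurable t).sub (hY.aemeasurable s))).symm
  have hts : 0 < (t : ℝ) - s := sub_pos.2 h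
  rw [h1, hY.map_sub h, lintegral_map hm (by fun_prop), negMoment, NNReal.coe_sub h.le,
    abs_of_pos hts, ← lintegral_const_mul _ hm]
  refine lintegral_congr fun x => ?_
  rw [abs_mul, abs_of_pos (by positivity), ENNReal.ofReal_mul (by positivity),
    ENNReal.mul_rpow_of_ne_top ENNReal.ofReal_ne_top ENNReal.ofReal_ne_top,
    ← ENNReal.ofReal_rpow_of_pos hts, ← ENNReal.rpow_mul]
  congr 2
  ring

end StableProcess

attribute [local irreducible] ballKernel meanKernel

/-! ### Expectations of products under independence -/

section Independence

lemma lintegral_pi_prod {ι S : Type*} [Fintype ι] [MeasurableSpace S] (m : ι → Measure S)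
    [∀ j, IsProbabilityMeasure (m j)] {f : ι → S → ℝ≥0∞} (hf : ∀ j, Measurable (f j)) :
    ∫⁻ x, ∏ j, f j (x j) ∂Measure.pi m = ∏ j, ∫⁻ y, f j y ∂m j := by
  have h := lintegral_prod_eq_prod_lintegral_of_indepFun (μ := Measure.pi m) Finset.univ
    (fun j x => f j (x j)) (iIndepFun_pi fun j => (hf j).aemeasurable)
    (fun j => (hf j).comp (measurable_pi_apply j))
  rw [h]
  refine Finset.prod_congr rfl fun j _ => ?_
  rw [← (measurePreserving_eval m j).lintegral_comp (hf j)]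

/-- The joint law of the two families is a product of product measures, so Tonelli integrates U with
V frozen, coordinate by coordinate. -/
lemma lintegral_prod_of_indep {Ω ι S S' : Type*} [MeasurableSpace Ω] [Fintype ι]
    [MeasurableSpace S] [MeasurableSpace S'] {P : Measure Ω} [IsProbabilityMeasure P]
    {U : ι → Ω → S} {V : ι → Ω → S'} (hU : ∀ j, AEMeasurable (U j) P)
    (hV : ∀ j, AEMeasurable (V j) P) (hUi : iIndepFun U P) (hVi : iIndepFun V P)
    (hUV : IndepFun (fun ω j => U j ω) (fun ω j => V j ω) P) {φ : S → S' → ℝ≥0∞}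
    (hφ : Measurable fun p : S × S' => φ p.1 p.2) :
    ∫⁻ ω, ∏ j, φ (U j ω) (V j ω) ∂P = ∏ j, ∫⁻ ω, ∫⁻ ω', φ (U j ω') (V j ω) ∂P ∂P := by
  have hUm : AEMeasurable (fun ω j => U j ω) P := aemeasurable_pi_lambda _ hU
  have hVm : AEMeasurable (fun ω j => V j ω) P := aemeasurable_pi_lambda _ hV
  have := fun j => Measure.isProbabilityMeasure_map (hU j)
  have := fun j => Measure.isProbabilityMeasure_map (hV j)
  have hF : Measurable fun p : (ι → S) × (ι → S') => ∏ j, φ (p.1 j) (p.2 j) := by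
    refine Finset.measurable_fun_prod _ fun j _ => ?_
    have hj : Measurable fun p : (ι → S) × (ι → S') => (p.1 j, p.2 j) :=
      ((measurable_pi_apply j).comp measurable_fst).prodMk
        ((measurable_pi_apply j).comp measurable_snd)
    exact hφ.comp hj
  have hφ' : Measurable fun p : S' × S => φ p.2 p.1 := hφ.comp measurable_swap
  have h1 : ∫⁻ ω, ∏ j, φ (U j ω) (V j ω) ∂P =
      ∫⁻ p, ∏ j, φ (p.1 j) (p.2 j) ∂P.map (fun ω => (fun j => U j ω, fun j => V j ω)) :=
    (lintegral_map' hF.aemeasurable (hUm.prodMk hVm)).symm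
  rw [h1, (indepFun_iff_map_prod_eq_prod_map_map hUm hVm).1 hUV,
    (iIndepFun_iff_map_fun_eq_pi_map hU).1 hUi, (iIndepFun_iff_map_fun_eq_pi_map hV).1 hVi,
    lintegral_prod_symm' _ hF]
  have h2 : ∀ y : ι → S', ∫⁻ x : ι → S, ∏ j, φ (x j) (y j) ∂Measure.pi (fun j => P.map (U j)) =
      ∏ j, ∫⁻ u, φ u (y j) ∂P.map (U j) := fun y =>
    lintegral_pi_prod _ (f := fun j u => φ u (y j)) fun j => hφ.comp measurable_prodMk_right
  simp_rw [h2]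
  rw [lintegral_pi_prod (fun j => P.map (V j)) (f := fun j v => ∫⁻ u, φ u v ∂P.map (U j))
    fun j => hφ'.lintegral_prod_right']
  refine Finset.prod_congr rfl fun j _ => ?_
  rw [lintegral_map' hφ'.lintegral_prod_right'.aemeasurable (hV j)]
  refine lintegral_congr fun ω => ?_
  exact lintegral_map' (hφ.comp measurable_prodMk_right).aemeasurable (hU j)

end Independence

/-! ### Measurable evaluation of a path at a random time -/

section PathEvaluation

/-- The value at `y` of the continuous function whose restriction to `ℚ` is `w`. -/
noncomputable def evalRat (w : ℚ → ℝ) (y : ℝ) : ℝ :=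
  limsup (fun n : ℕ => w (⌊y * n⌋ / n)) atTop

/-- Evaluation at a random point is not measurable for the product σ-algebra on `ℝ → ℝ`. Restricting
paths to the countable set ℚ repairs this and loses nothing for continuous paths. -/
lemma measurable_evalRat {A : Type*} [MeasurableSpace A] {f : A → ℚ → ℝ} {g : A → ℝ}
    (hf : Measurable f) (hg : Measurable g) : Measurable fun a => evalRat (f a) (g a) := by
  refine Measurable.limsup fun n => ?_
  have h1 : Measurable fun q : (ℚ → ℝ) × ℤ => q.1 (q.2 / n) :=
    measurable_from_prod_countable_left fun k => measurable_pi_apply (k / n : ℚ)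
  exact h1.comp (hf.prodMk (hg.mul_const _).floor)

lemma evalRat_of_continuous {f : ℝ → ℝ} (hf : Continuous f) (y : ℝ) :
    evalRat (fun q => f q) y = f y := by
  have h : Tendsto (fun n : ℕ => ((⌊y * n⌋ / n : ℚ) : ℝ)) atTop (𝓝 y) := by
    have hlow : Tendsto (fun n : ℕ => y - 1 / (n : ℝ)) atTop (𝓝 y) := by
      simpa using tendsto_const_nhds.sub (tendsto_one_div_atTop_nhds_zero_nat (𝕜 := ℝ))
    refine tendsto_of_tendsto_of_tendsto_of_le_of_le' hlow tendsto_const_nhds ?_ ?_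
    · filter_upwards [eventually_gt_atTop 0] with n hn
      have hn' : (0 : ℝ) < n := Nat.cast_pos.2 hn
      push_cast
      rw [le_div_iff₀ hn', sub_mul, one_div_mul_cancel hn'.ne']
      exact (Int.sub_one_lt_floor _).le
    · filter_upwards [eventually_gt_atTop 0] with n hn
      have hn' : (0 : ℝ) < n := Nat.cast_pos.2 hn
      push_cast
      rw [div_le_iff₀ hn']
      exact Int.floor_le _
  exact ((hf.tendsto y).comp h).limsup_eq

attribute [irreducible] evalRat

end PathEvaluation

/-! ### The time-changed process and factorization of its kernel -/

section TimeChange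

lemma measurable_ballKernel_evalRat {A : Type*} [MeasurableSpace A] {f : A → ℚ → ℝ} {g h : A → ℝ}
    (hf : Measurable f) (hg : Measurable g) (hh : Measurable h) (r : ℝ) :
    Measurable fun a =>
      ballKernel (volume : Measure ℝ) r (evalRat (f a) (g a)) (evalRat (f a) (h a)) := by
  have hk : Measurable fun p : ℝ × ℝ => ballKernel (volume : Measure ℝ) r p.1 p.2 :=
    measurable_ballKernel volume r
  have hp : Measurable fun a => (evalRat (f a) (g a), evalRat (f a) (h a)) :=
    (measurable_evalRat hf hg).prodMk (measurable_evalRat hf hh)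
  exact hk.comp hp

variable {Ω : Type*} [MeasurableSpace Ω] {P : Measure Ω} {H : ℝ}

lemma IsFractionalBrownianMotion.aemeasurable_rat {W : ℝ → Ω → ℝ}
    (hW : IsFractionalBrownianMotion H W P) : AEMeasurable (fun ω (q : ℚ) => W q ω) P :=
  aemeasurable_pi_lambda _ fun q => hW.isGaussianProcess.aemeasurable q

lemma IsFractionalBrownianMotion.ae_evalRat {W : ℝ → Ω → ℝ}
    (hW : IsFractionalBrownianMotion H W P) :
    ∀ᵐ ω ∂P, ∀ y, W y ω = evalRat (fun q => W q ω) y := by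
  filter_upwards [hW.continuous_paths] with ω hω y
  exact (evalRat_of_continuous hω y).symm

lemma aemeasurable_timeChange {α : ℝ} {W : ℝ → Ω → ℝ} {Y : ℝ≥0 → Ω → ℝ} {σ β : ℝ}
    (hW : IsFractionalBrownianMotion H W P) (hY : IsStrictlyStableLevyProcess α σ β Y P) :
    AEMeasurable (fun p : ℝ × Ω => W (Y p.1.toNNReal p.2) p.2)
      ((volume.restrict (Set.Ici 0)).prod P) := by
  have h1 : AEMeasurable (fun p : ℝ × Ω => evalRat (fun q => W q p.2) (Y p.1.toNNReal p.2))
      ((volume.restrict (Set.Ici 0)).prod P) :=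
    Measurable.comp_aemeasurable (g := fun q : (ℚ → ℝ) × ℝ => evalRat q.1 q.2)
      (measurable_evalRat measurable_fst measurable_snd)
      (hW.aemeasurable_rat.comp_snd.prodMk hY.measurable_process)
  refine h1.congr ?_
  filter_upwards [Measure.quasiMeasurePreserving_snd.ae hW.ae_evalRat] with p hp
  exact (hp _).symm

variable [IsProbabilityMeasure P] {α : ℝ} {d : ℕ}

/-- Both the kernel and the law factor over coordinates, once each path of W is replaced by its
restriction to ℚ. -/
lemma lintegral_ballKernel_timeChange {W : Fin d → ℝ → Ω → ℝ} {Y : Fin d → ℝ≥0 → Ω → ℝ}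
    {σ β : ℝ} (hW : ∀ j, IsFractionalBrownianMotion H (W j) P)
    (hY : ∀ j, IsStrictlyStableLevyProcess α σ β (Y j) P)
    (hWi : iIndepFun (fun (j : Fin d) (ω : Ω) (t : ℝ) => W j t ω) P)
    (hYi : iIndepFun (fun (j : Fin d) (ω : Ω) (t : ℝ≥0) => Y j t ω) P)
    (hWY : IndepFun (fun (ω : Ω) (j : Fin d) (t : ℝ) => W j t ω)
      (fun (ω : Ω) (j : Fin d) (t : ℝ≥0) => Y j t ω) P) {r : ℝ} (hr : 0 < r) (s t : ℝ≥0) :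
    ∫⁻ ω, ballKernel (volume : Measure (Fin d → ℝ)) r (fun j => W j (Y j s ω) ω)
        (fun j => W j (Y j t ω) ω) ∂P =
      ∏ j, ∫⁻ ω, meanKernel P (W j) r (Y j s ω) (Y j t ω) ∂P := by
  let U : Fin d → Ω → ℚ → ℝ := fun j ω q => W j q ω
  let V : Fin d → Ω → ℝ × ℝ := fun j ω => (Y j s ω, Y j t ω)
  let φ : (ℚ → ℝ) → ℝ × ℝ → ℝ≥0∞ := fun w y =>
    ballKernel (volume : Measure ℝ) r (evalRat w y.1) (evalRat w y.2)
  have hφ : Measurable fun p : (ℚ → ℝ) × ℝ × ℝ => φ p.1 p.2 :=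
    measurable_ballKernel_evalRat measurable_fst (measurable_fst.comp measurable_snd)
      (measurable_snd.comp measurable_snd) r
  have hUi : iIndepFun U P := hWi.comp (fun _ w (q : ℚ) => w q) fun _ => by fun_prop
  have hVi : iIndepFun V P := hYi.comp (fun _ y => (y s, y t)) fun _ => by fun_prop
  have hUV : IndepFun (fun ω j => U j ω) (fun ω j => V j ω) P :=
    IndepFun.comp (φ := fun (w : Fin d → ℝ → ℝ) j (q : ℚ) => w j q)
      (ψ := fun (y : Fin d → ℝ≥0 → ℝ) j => (y j s, y j t)) hWY (by fun_prop) (by fun_prop)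
  -- The exceptional set does not depend on y, so random times may be substituted.
  have hev : ∀ᵐ ω ∂P, ∀ j y, W j y ω = evalRat (U j ω) y :=
    ae_all_iff.2 fun j => (hW j).ae_evalRat
  have h1 : ∫⁻ ω, ballKernel (volume : Measure (Fin d → ℝ)) r (fun j => W j (Y j s ω) ω)
        (fun j => W j (Y j t ω) ω) ∂P = ∫⁻ ω, ∏ j, φ (U j ω) (V j ω) ∂P := by
    refine lintegral_congr_ae ?_
    filter_upwards [hev] with ω hω
    rw [ballKernel_pi hr]
    refine Finset.prod_congr rfl fun j _ => ?_
    rw [hω j, hω j]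
  rw [h1, lintegral_prod_of_indep (fun j => (hW j).aemeasurable_rat)
    (fun j => ((hY j).aemeasurable s).prodMk ((hY j).aemeasurable t)) hUi hVi hUV hφ]
  refine Finset.prod_congr rfl fun j _ => lintegral_congr fun ω => ?_
  rw [meanKernel]
  refine lintegral_congr_ae ?_
  filter_upwards [hev] with ω' hω'
  rw [hω' j, hω' j]

end TimeChange

/-! ### Two-sided bounds for the averaged mean kernel -/

section MomentBounds

variable {Ω : Type*} [MeasurableSpace Ω] {P : Measure Ω} [IsProbabilityMeasure P] {α σ β H : ℝ}
  {W : ℝ → Ω → ℝ} {Y : ℝ≥0 → Ω → ℝ}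

lemma lintegral_meanKernel_le (hW : IsFractionalBrownianMotion H W P)
    (hY : IsStrictlyStableLevyProcess α σ β Y P) (hH : 0 < H) {r : ℝ} (hr : 0 < r) {s t : ℝ≥0}
    (hst : s ≠ t) :
    ∫⁻ ω, meanKernel P W r (Y t ω) (Y s ω) ∂P ≤
      2 * (ENNReal.ofReal |(t : ℝ) - s| ^ (-(H / α)) * negMoment P Y H) := by
  rw [← hY.lintegral_abs_sub hst, ← lintegral_const_mul' _ _ (by simp)]
  exact lintegral_mono fun ω => hW.meanKernel_le hH hr _ _

lemma measurable_meanKernel (hW : IsFractionalBrownianMotion H W P) (r : ℝ) :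
    Measurable fun p : ℝ × ℝ => meanKernel P W r p.1 p.2 := by
  have hU := hW.aemeasurable_rat
  have h : ∀ p : ℝ × ℝ, meanKernel P W r p.1 p.2 = ∫⁻ w, ballKernel (volume : Measure ℝ) r
      (evalRat w p.1) (evalRat w p.2) ∂P.map (fun ω (q : ℚ) => W q ω) := by
    intro p
    rw [meanKernel, lintegral_map' _ hU]
    · refine lintegral_congr_ae ?_
      filter_upwards [hW.ae_evalRat] with ω hω
      rw [hω, hω]
    · exact (measurable_ballKernel_evalRat measurable_id measurable_const measurable_const
        r).aemeasurable
  have := Measure.isProbabilityMeasure_map hU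
  simp_rw [h]
  exact Measurable.lintegral_prod_right' (f := fun q : (ℝ × ℝ) × (ℚ → ℝ) =>
    ballKernel (volume : Measure ℝ) r (evalRat q.2 q.1.1) (evalRat q.2 q.1.2))
    (measurable_ballKernel_evalRat measurable_snd (measurable_fst.comp measurable_fst)
      (measurable_snd.comp measurable_fst) r)

/-- A lower bound for the mean kernel at a fixed pair of distinct times, for small radii. -/
lemma le_liminf_lintegral_meanKernel (hY : IsStrictlyStableLevyProcess α σ β Y P) (hH : 0 < H)
    (hH1 : H < 1) (hW : IsFractionalBrownianMotion H W P) {c : ℝ≥0∞}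
    (hc : ∀ {r s t : ℝ}, 0 < r → r ≤ |s - t| ^ H → s ≠ t →
      c * ENNReal.ofReal |s - t| ^ (-H) ≤ meanKernel P W r s t)
    {r : ℕ → ℝ} (hr : ∀ n, 0 < r n) (hr0 : Tendsto r atTop (𝓝 0)) {s t : ℝ≥0} (hst : s ≠ t) :
    c * (ENNReal.ofReal |(t : ℝ) - s| ^ (-(H / α)) * negMoment P Y H) ≤
      liminf (fun n => ∫⁻ ω, meanKernel P W (r n) (Y t ω) (Y s ω) ∂P) atTop := by
  have hmY : AEMeasurable (fun ω => (Y t ω, Y s ω)) P :=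
    (hY.aemeasurable t).prodMk (hY.aemeasurable s)
  have hfin : ∫⁻ ω, ENNReal.ofReal |Y t ω - Y s ω| ^ (-H) ∂P < ∞ := by
    rw [hY.lintegral_abs_sub hst]
    refine ENNReal.mul_lt_top ?_ (hY.negMoment_lt_top hH hH1)
    rw [ENNReal.ofReal_rpow_of_pos (abs_pos.2 (sub_ne_zero.2 (NNReal.coe_injective.ne hst.symm)))]
    exact ENNReal.ofReal_lt_top
  have hm : AEMeasurable (fun ω => ENNReal.ofReal |Y t ω - Y s ω| ^ (-H)) P :=
    (by fun_prop : Measurable fun p : ℝ × ℝ => ENNReal.ofReal |p.1 - p.2| ^ (-H)).comp_aemeasurable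
      hmY
  rw [← hY.lintegral_abs_sub hst, ← lintegral_const_mul'' _ hm]
  refine le_trans (lintegral_mono_ae ?_) (lintegral_liminf_le' fun n =>
    (measurable_meanKernel hW (r n)).comp_aemeasurable hmY)
  -- Finiteness of the negative moment forces Y(t) ≠ Y(s) almost surely, so every small enough
  -- radius satisfies the condition in `hc`.
  filter_upwards [ae_lt_top' hm hfin.ne] with ω hω
  have hne : Y t ω ≠ Y s ω := by
    intro h
    simp [h, hH] at hω
  have hpos : 0 < |Y t ω - Y s ω| ^ H :=
    Real.rpow_pos_of_pos (abs_pos.2 (sub_ne_zero.2 hne)) _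
  refine le_liminf_of_le (by isBoundedDefault) ?_
  filter_upwards [hr0.eventually (gt_mem_nhds hpos)] with n hn
  exact hc (hr n) hn.le hne

end MomentBounds

/-! ### The energy integral in time -/

section TimeIntegral

lemma measurable_ofReal_abs_rpow (γ : ℝ) : Measurable fun u : ℝ => ENNReal.ofReal |u| ^ γ := by
  fun_prop

lemma setLIntegral_Ioo_rpow_neg_lt_top_iff {γ a : ℝ} (ha : 0 < a) :
    ∫⁻ u in Set.Ioo 0 a, ENNReal.ofReal |u| ^ (-γ) < ∞ ↔ γ < 1 := by
  have h1 : ∫⁻ u in Set.Ioo 0 a, ENNReal.ofReal |u| ^ (-γ) =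
      ∫⁻ u in Set.Ioo 0 a, ‖u ^ (-γ)‖ₑ := by
    refine setLIntegral_congr_fun measurableSet_Ioo fun u hu => ?_
    have hu0 : 0 < u := hu.1
    rw [abs_of_pos hu0, ENNReal.ofReal_rpow_of_pos hu0, Real.enorm_of_nonneg (by positivity)]
  have h2 := intervalIntegral.integrableOn_Ioo_rpow_iff (s := -γ) ha
  rw [h1, ← neg_lt_neg_iff (a := (1 : ℝ)), ← h2]
  refine ⟨fun h => ⟨by fun_prop, h⟩, fun h => h.2⟩

/-- After u = t - s, finiteness for a single t in (0,T) already gives integrability of u^(-γ) near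
0; conversely one integral over a symmetric interval bounds the inner integral for all t. -/
lemma lintegral_lintegral_rpow_neg_lt_top_iff {T : ℝ} (hT : 0 < T) {γ : ℝ} :
    ∫⁻ t in Set.Icc 0 T, ∫⁻ s in Set.Icc 0 T, ENNReal.ofReal |t - s| ^ (-γ) < ∞ ↔ γ < 1 := by
  have hg := measurable_ofReal_abs_rpow (-γ)
  constructor
  · intro h
    have hm : Measurable fun t : ℝ => ∫⁻ s in Set.Icc 0 T, ENNReal.ofReal |t - s| ^ (-γ) :=
      Measurable.lintegral_prod_right' (f := fun p : ℝ × ℝ => ENNReal.ofReal |p.1 - p.2| ^ (-γ))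
        (by fun_prop)
    have h1 : ∀ᵐ t ∂volume.restrict (Set.Ioo 0 T),
        ∫⁻ s in Set.Icc 0 T, ENNReal.ofReal |t - s| ^ (-γ) < ∞ :=
      ae_mono (Measure.restrict_mono Set.Ioo_subset_Icc_self le_rfl) (ae_lt_top hm h.ne)
    have hne : (ae (volume.restrict (Set.Ioo 0 T))).NeBot := by
      rw [ae_neBot, ne_eq, Measure.restrict_eq_zero, Real.volume_Ioo]
      simpa using hT
    obtain ⟨t, ht, htm⟩ := (h1.and (ae_restrict_mem measurableSet_Ioo)).exists
    rw [← setLIntegral_Ioo_rpow_neg_lt_top_iff htm.1]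
    refine lt_of_le_of_lt ?_ ht
    rw [← lintegral_indicator measurableSet_Ioo, ← lintegral_indicator measurableSet_Icc,
      ← lintegral_sub_left_eq_self _ t]
    refine lintegral_mono fun s => ?_
    by_cases hs : t - s ∈ Set.Ioo 0 t
    · have : s ∈ Set.Icc 0 T := ⟨by linarith [hs.2], by linarith [hs.1, htm.2]⟩
      rw [Set.indicator_of_mem hs, Set.indicator_of_mem this]
    · rw [Set.indicator_of_notMem hs]; exact zero_le
  · intro h
    -- With T + 1 in place of T, all differences t - s fall inside the open interval.
    have hpos := (setLIntegral_Ioo_rpow_neg_lt_top_iff (a := T + 1) (by linarith)).2 h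
    have hneg : ∫⁻ u in Set.Ioo (-(T + 1)) 0, ENNReal.ofReal |u| ^ (-γ) < ∞ := by
      have := (Measure.measurePreserving_neg (volume : Measure ℝ)).setLIntegral_comp_preimage
        (measurableSet_Ioo (a := 0) (b := T + 1)) hg
      rw [← this] at hpos
      simpa using hpos
    have hb : ∫⁻ u in Set.Ioo (-(T + 1)) (T + 1), ENNReal.ofReal |u| ^ (-γ) < ∞ := by
      have hsub : Set.Ioo (-(T + 1)) (T + 1) ≤ᵐ[volume]
          (Set.Ioo (-(T + 1)) 0 ∪ Set.Ioo 0 (T + 1) : Set ℝ) := by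
        filter_upwards [Measure.ae_ne volume (0 : ℝ)] with u hu hmem
        rcases lt_or_gt_of_ne hu with h0 | h0
        · exact Or.inl ⟨hmem.1, h0⟩
        · exact Or.inr ⟨h0, hmem.2⟩
      exact (lintegral_mono' (Measure.restrict_mono_ae hsub) le_rfl).trans_lt
        ((lintegral_union_le _ _ _).trans_lt (ENNReal.add_lt_top.2 ⟨hneg, hpos⟩))
    have hle : ∀ t ∈ Set.Icc 0 T, ∫⁻ s in Set.Icc 0 T, ENNReal.ofReal |t - s| ^ (-γ) ≤
        ∫⁻ u in Set.Ioo (-(T + 1)) (T + 1), ENNReal.ofReal |u| ^ (-γ) := by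
      intro t ht
      rw [← lintegral_indicator measurableSet_Ioo, ← lintegral_indicator measurableSet_Icc,
        ← lintegral_sub_left_eq_self ((Set.Ioo (-(T + 1)) (T + 1)).indicator
          fun u => ENNReal.ofReal |u| ^ (-γ)) t]
      refine lintegral_mono fun s => ?_
      by_cases hs : s ∈ Set.Icc 0 T
      · have : t - s ∈ Set.Ioo (-(T + 1)) (T + 1) :=
          ⟨by linarith [hs.2, ht.1], by linarith [hs.1, ht.2]⟩
        rw [Set.indicator_of_mem hs, Set.indicator_of_mem this]
      · rw [Set.indicator_of_notMem hs]; exact zero_le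
    refine (setLIntegral_mono' measurableSet_Icc hle).trans_lt ?_
    rw [lintegral_const]
    exact ENNReal.mul_lt_top hb (by simp)

end TimeIntegral

/-! ### Product bounds over the d coordinates -/

section KernelIntegral

variable {Ω : Type*} [MeasurableSpace Ω] {P : Measure Ω} [IsProbabilityMeasure P]
  {α σ β H : ℝ} {d : ℕ} {W : Fin d → ℝ → Ω → ℝ} {Y : Fin d → ℝ≥0 → Ω → ℝ}

lemma prod_mul_ofReal_rpow {d : ℕ} (m : Fin d → ℝ≥0∞) (x : ℝ≥0∞) (h : ℝ) :
    ∏ j, (m j * x ^ (-h)) = (∏ j, m j) * x ^ (-(h * d)) := by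
  rw [Finset.prod_mul_distrib, Finset.prod_const, Finset.card_univ, Fintype.card_fin,
    ← ENNReal.rpow_natCast, ← ENNReal.rpow_mul, neg_mul]

lemma exists_prod_meanKernel_le (hW : ∀ j, IsFractionalBrownianMotion H (W j) P)
    (hY : ∀ j, IsStrictlyStableLevyProcess α σ β (Y j) P) (hH : 0 < H) (hH1 : H < 1) :
    ∃ D : ℝ≥0∞, D ≠ ∞ ∧ ∀ r, 0 < r → ∀ s t : ℝ≥0, s ≠ t →
      ∏ j, ∫⁻ ω, meanKernel P (W j) r (Y j t ω) (Y j s ω) ∂P ≤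
        D * ENNReal.ofReal |(t : ℝ) - s| ^ (-(H / α * d)) := by
  refine ⟨∏ j, 2 * negMoment P (Y j) H, ?_, fun r hr s t hst => ?_⟩
  · exact ENNReal.prod_ne_top fun j _ =>
      ENNReal.mul_ne_top (by simp) ((hY j).negMoment_lt_top hH hH1).ne
  · rw [← prod_mul_ofReal_rpow]
    refine Finset.prod_le_prod' fun j _ => ?_
    refine (lintegral_meanKernel_le (hW j) (hY j) hH hr hst).trans_eq ?_
    ring

lemma exists_le_liminf_prod_meanKernel (hW : ∀ j, IsFractionalBrownianMotion H (W j) P)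
    (hY : ∀ j, IsStrictlyStableLevyProcess α σ β (Y j) P) (hH : 0 < H) (hH1 : H < 1)
    {r : ℕ → ℝ} (hr : ∀ n, 0 < r n) (hr0 : Tendsto r atTop (𝓝 0)) :
    ∃ D : ℝ≥0∞, D ≠ 0 ∧ ∀ s t : ℝ≥0, s ≠ t →
      D * ENNReal.ofReal |(t : ℝ) - s| ^ (-(H / α * d)) ≤
        liminf (fun n => ∏ j, ∫⁻ ω, meanKernel P (W j) (r n) (Y j t ω) (Y j s ω) ∂P) atTop := by
  obtain ⟨c, hc0, hct, hc⟩ := IsFractionalBrownianMotion.exists_le_meanKernel P hH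
  -- Halving makes each coordinate bound strictly smaller than its liminf, so all finitely many
  -- bounds hold eventually and can be multiplied.
  refine ⟨∏ j, c * negMoment P (Y j) H / 2, ?_, fun s t hst => ?_⟩
  · rw [Finset.prod_ne_zero_iff]
    intro j _
    exact ENNReal.div_ne_zero.2 ⟨mul_ne_zero hc0 ((hY j).negMoment_ne_zero hH), by simp⟩
  have hts : 0 < |(t : ℝ) - s| := abs_pos.2 (sub_ne_zero.2 (NNReal.coe_injective.ne hst.symm))
  have hq0 : ENNReal.ofReal |(t : ℝ) - s| ^ (-(H / α)) ≠ 0 := by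
    rw [ENNReal.ofReal_rpow_of_pos hts, ne_eq, ENNReal.ofReal_eq_zero, not_le]
    positivity
  have hqt : ENNReal.ofReal |(t : ℝ) - s| ^ (-(H / α)) ≠ ∞ := by
    rw [ENNReal.ofReal_rpow_of_pos hts]
    exact ENNReal.ofReal_ne_top
  have hev : ∀ᶠ n in atTop, ∀ j,
      c * negMoment P (Y j) H / 2 * ENNReal.ofReal |(t : ℝ) - s| ^ (-(H / α)) ≤
        ∫⁻ ω, meanKernel P (W j) (r n) (Y j t ω) (Y j s ω) ∂P := by
    refine eventually_all.2 fun j => ?_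
    have h1 := le_liminf_lintegral_meanKernel (hY j) hH hH1 (hW j) (fun h1 h2 h3 => hc (hW j) h1 h2 h3)
      hr hr0 hst
    have hM0 := (hY j).negMoment_ne_zero hH
    have hMt := ((hY j).negMoment_lt_top hH hH1).ne
    have h2 : c * negMoment P (Y j) H / 2 * ENNReal.ofReal |(t : ℝ) - s| ^ (-(H / α)) <
        c * (ENNReal.ofReal |(t : ℝ) - s| ^ (-(H / α)) * negMoment P (Y j) H) := by
      rw [show c * negMoment P (Y j) H / 2 * ENNReal.ofReal |(t : ℝ) - s| ^ (-(H / α)) =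
        c * (ENNReal.ofReal |(t : ℝ) - s| ^ (-(H / α)) * negMoment P (Y j) H) / 2 by
          simp only [ENNReal.div_eq_inv_mul]; ring]
      exact ENNReal.half_lt_self (mul_ne_zero hc0 (mul_ne_zero hq0 hM0))
        (ENNReal.mul_ne_top hct (ENNReal.mul_ne_top hqt hMt))
    exact (eventually_lt_of_lt_liminf (h2.trans_le h1)).mono fun n hn => hn.le
  rw [← prod_mul_ofReal_rpow]
  refine le_liminf_of_le (by isBoundedDefault) ?_
  filter_upwards [hev] with n hn
  exact Finset.prod_le_prod' fun j _ => hn j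

end KernelIntegral

/-! ### Transfer between Euclidean space and the sup-norm space -/

section LocalTime

lemma map_withDensity_of_measurePreserving {A B : Type*} [MeasurableSpace A] [MeasurableSpace B]
    {a : Measure A} {b : Measure B} (e : A ≃ᵐ B) (he : MeasurePreserving e a b) (f : B → ℝ≥0∞)
    (hf : Measurable f) : (a.withDensity fun x => f (e x)).map e = b.withDensity f := by
  ext s hs
  rw [Measure.map_apply e.measurable hs, withDensity_apply _ (e.measurable hs),
    withDensity_apply _ hs, he.setLIntegral_comp_preimage hs hf]

variable {d : ℕ}

/-- The occupation measure of a path that agrees almost everywhere with a `Fin d → ℝ`-valued one. -/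
lemma occupationMeasure_eq_map {x : ℝ → EuclideanSpace ℝ (Fin d)} {B : Set ℝ} {z : ℝ → Fin d → ℝ}
    (h : (fun t => WithLp.ofLp (x t)) =ᵐ[volume.restrict B] z) (hz : Measurable z) :
    AEMeasurable x (volume.restrict B) ∧ occupationMeasure x B =
      ((volume.restrict B).map z).map (MeasurableEquiv.toLp 2 (Fin d → ℝ)) := by
  have h1 : x =ᵐ[volume.restrict B] fun t => MeasurableEquiv.toLp 2 (Fin d → ℝ) (z t) := by
    filter_upwards [h] with t ht
    rw [← ht]
    rfl
  have hm : Measurable fun t => MeasurableEquiv.toLp 2 (Fin d → ℝ) (z t) :=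
    (MeasurableEquiv.toLp 2 (Fin d → ℝ)).measurable.comp hz
  refine ⟨⟨_, hm, h1⟩, ?_⟩
  rw [occupationMeasure, Measure.map_congr h1, Measure.map_map (MeasurableEquiv.measurable _) hz]
  rfl

lemma measurePreserving_toLp :
    MeasurePreserving (MeasurableEquiv.toLp 2 (Fin d → ℝ)) volume volume :=
  PiLp.volume_preserving_toLp (Fin d)

lemma isLocalTime_of_map_eq_withDensity {x : ℝ → EuclideanSpace ℝ (Fin d)} {B : Set ℝ}
    {z : ℝ → Fin d → ℝ} (h : (fun t => WithLp.ofLp (x t)) =ᵐ[volume.restrict B] z)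
    (hz : Measurable z) {g : (Fin d → ℝ) → ℝ≥0∞} (hg : Measurable g)
    (hgz : (volume.restrict B).map z = volume.withDensity g) :
    IsLocalTime x B fun y => (g (WithLp.ofLp y)).toReal := by
  obtain ⟨hx, hocc⟩ := occupationMeasure_eq_map h hz
  have hg' : Measurable fun y : EuclideanSpace ℝ (Fin d) => g (WithLp.ofLp y) :=
    hg.comp (MeasurableEquiv.toLp 2 (Fin d → ℝ)).symm.measurable
  have h1 : occupationMeasure x B = volume.withDensity fun y => g (WithLp.ofLp y) := by
    rw [hocc, hgz, ← map_withDensity_of_measurePreserving _ measurePreserving_toLp _ hg']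
    rfl
  refine ⟨hx, ?_, ?_⟩
  · rw [h1]
    exact withDensity_absolutelyContinuous _ _
  · rw [h1]
    filter_upwards [Measure.rnDeriv_withDensity volume hg'] with y hy
    rw [hy]

lemma IsLocalTime.exists_density {x : ℝ → EuclideanSpace ℝ (Fin d)} {B : Set ℝ}
    [IsFiniteMeasure ((volume : Measure ℝ).restrict B)]
    {ℓ : EuclideanSpace ℝ (Fin d) → ℝ} (hℓ : IsLocalTime x B ℓ) {z : ℝ → Fin d → ℝ}
    (h : (fun t => WithLp.ofLp (x t)) =ᵐ[volume.restrict B] z) (hz : Measurable z) :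
    ∃ g : (Fin d → ℝ) → ℝ≥0∞, Measurable g ∧
      (volume.restrict B).map z = volume.withDensity g ∧ ∫⁻ y, g y ^ 2 = ∫⁻ y, ‖ℓ y‖ₑ ^ 2 := by
  obtain ⟨-, hocc⟩ := occupationMeasure_eq_map h hz
  set e := MeasurableEquiv.toLp 2 (Fin d → ℝ) with he
  have hfin : IsFiniteMeasure (occupationMeasure x B) := by
    rw [occupationMeasure]; infer_instance
  set ρ := (occupationMeasure x B).rnDeriv volume with hρ
  have hρm : Measurable ρ := Measure.measurable_rnDeriv _ _
  refine ⟨fun y => ρ (e y), hρm.comp e.measurable, ?_, ?_⟩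
  · have h1 := map_withDensity_of_measurePreserving e.symm
      (measurePreserving_toLp (d := d)).symm (fun y => ρ (e y)) (hρm.comp e.measurable)
    simp only [MeasurableEquiv.apply_symm_apply] at h1
    rw [← h1, hρ, Measure.withDensity_rnDeriv_eq _ _ hℓ.absolutelyContinuous, hocc,
      Measure.map_map e.symm.measurable e.measurable]
    simp
  · rw [(measurePreserving_toLp (d := d)).lintegral_comp (hρm.pow_const 2)]
    refine lintegral_congr_ae ?_
    -- The occupation measure is finite, so its derivative is finite almost everywhere and `toReal`
    -- loses nothing.
    filter_upwards [hℓ.ae_eq_rnDeriv, Measure.rnDeriv_lt_top (occupationMeasure x B) volume]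
      with y hy hlt
    rw [hy, Real.enorm_of_nonneg ENNReal.toReal_nonneg, ENNReal.ofReal_toReal hlt.ne]

end LocalTime

/-! ### The criterion for a square integrable local time -/

section Criterion

variable {Ω : Type*} [MeasurableSpace Ω] {P : Measure Ω} [IsProbabilityMeasure P]
  {α H : ℝ} {d : ℕ} {X : ℝ≥0 → Ω → EuclideanSpace ℝ (Fin d)}

/-- A jointly measurable modification of the coordinates of `X` on `[0, T]`. -/
lemma exists_measurable_modification
    (hm : AEMeasurable (fun p : ℝ × Ω => WithLp.ofLp (X p.1.toNNReal p.2))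
      ((volume.restrict (Set.Ici 0)).prod P)) (T : ℝ) :
    ∃ Z : ℝ × Ω → Fin d → ℝ, Measurable Z ∧
      (∀ᵐ ω ∂P, (fun t : ℝ => WithLp.ofLp (X t.toNNReal ω)) =ᵐ[volume.restrict (Set.Icc 0 T)]
        fun t => Z (t, ω)) ∧
      ∀ᵐ t ∂(volume.restrict (Set.Icc 0 T) : Measure ℝ), ∀ᵐ ω ∂P,
        WithLp.ofLp (X t.toNNReal ω) = Z (t, ω) := by
  have hle : (volume.restrict (Set.Icc 0 T) : Measure ℝ).prod P ≪
      (volume.restrict (Set.Ici 0)).prod P :=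
    (Measure.absolutelyContinuous_of_le
      (Measure.restrict_mono Set.Icc_subset_Ici_self le_rfl)).prod Measure.AbsolutelyContinuous.rfl
  obtain ⟨Z, hZ, h⟩ := hm.mono_ac hle
  -- One null set is sliced both ways: along paths for occupation measures, at fixed times for
  -- expectations.
  refine ⟨Z, hZ, ?_, Measure.ae_ae_of_ae_prod h⟩
  have h2 : ∀ᵐ q ∂P.prod (volume.restrict (Set.Icc 0 T) : Measure ℝ),
      WithLp.ofLp (X q.2.toNNReal q.1) = Z (q.2, q.1) := by
    rw [← Measure.prod_swap] at h
    exact ae_of_ae_map measurable_swap.aemeasurable h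
  exact Measure.ae_ae_of_ae_prod h2

/-- The modification agrees with X only at almost every time, so the product formula holds for
almost every pair; the null diagonal is discarded as well. -/
lemma lintegral_ballKernel_modification {W : Fin d → ℝ → Ω → ℝ} {Y : Fin d → ℝ≥0 → Ω → ℝ}
    {σ β : ℝ} (hW : ∀ j, IsFractionalBrownianMotion H (W j) P)
    (hY : ∀ j, IsStrictlyStableLevyProcess α σ β (Y j) P)
    (hWi : iIndepFun (fun (j : Fin d) (ω : Ω) (t : ℝ) => W j t ω) P)
    (hYi : iIndepFun (fun (j : Fin d) (ω : Ω) (t : ℝ≥0) => Y j t ω) P)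
    (hWY : IndepFun (fun (ω : Ω) (j : Fin d) (t : ℝ) => W j t ω)
      (fun (ω : Ω) (j : Fin d) (t : ℝ≥0) => Y j t ω) P)
    (hX : ∀ t ω j, X t ω j = W j (Y j t ω) ω) {T : ℝ} {Z : ℝ × Ω → Fin d → ℝ}
    (hZ : ∀ᵐ t ∂(volume.restrict (Set.Icc 0 T) : Measure ℝ), ∀ᵐ ω ∂P,
        WithLp.ofLp (X t.toNNReal ω) = Z (t, ω)) :
    ∀ᵐ t ∂(volume.restrict (Set.Icc 0 T) : Measure ℝ),
      ∀ᵐ s ∂(volume.restrict (Set.Icc 0 T) : Measure ℝ),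
      s.toNNReal ≠ t.toNNReal ∧ |((t.toNNReal : ℝ≥0) : ℝ) - (s.toNNReal : ℝ≥0)| = |t - s| ∧
      ∀ r, 0 < r → ∫⁻ ω, ballKernel (volume : Measure (Fin d → ℝ)) r (Z (t, ω)) (Z (s, ω)) ∂P =
        ∏ j, ∫⁻ ω, meanKernel P (W j) r (Y j t.toNNReal ω) (Y j s.toNNReal ω) ∂P := by
  filter_upwards [hZ, ae_restrict_mem measurableSet_Icc] with t ht htm
  filter_upwards [hZ, ae_restrict_mem measurableSet_Icc,
    ae_restrict_of_ae (Measure.ae_ne volume t)] with s hs hsm hst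
  refine ⟨?_, ?_, fun r hr => ?_⟩
  · rwa [ne_eq, Real.toNNReal_eq_toNNReal_iff hsm.1 htm.1]
  · rw [Real.coe_toNNReal _ htm.1, Real.coe_toNNReal _ hsm.1]
  · rw [← lintegral_ballKernel_timeChange hW hY hWi hYi hWY hr]
    refine lintegral_congr_ae ?_
    filter_upwards [ht, hs] with ω h1 h2
    rw [← h1, ← h2]
    congr 1
    · ext j; exact hX _ _ _
    · ext j; exact hX _ _ _

/-- A square integrable local time on `[0, T]` exists if and only if `d < α / H`. -/
theorem IsAlphaTimeFractionalBrownianMotion.exists_localTime_iff (hα : 0 < α) (hH : 0 < H)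
    (hH1 : H < 1) (hX : IsAlphaTimeFractionalBrownianMotion α H X P)
    {T : ℝ} (hT : 0 < T) :
    (∃ L : Ω → EuclideanSpace ℝ (Fin d) → ℝ,
      MemLp (fun p : Ω × EuclideanSpace ℝ (Fin d) => L p.1 p.2) 2 (P.prod volume) ∧
      ∀ᵐ ω ∂P, IsLocalTime (fun t : ℝ => X t.toNNReal ω) (Set.Icc 0 T) (L ω)) ↔
    (d : ℝ) < α / H := by
  obtain ⟨σ, β, W, Y, hW, hY, hWi, hYi, hWY, hXW⟩ := hX
  have hXm : AEMeasurable (fun p : ℝ × Ω => WithLp.ofLp (X p.1.toNNReal p.2))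
      ((volume.restrict (Set.Ici 0)).prod P) := by
    refine aemeasurable_pi_lambda _ fun j => ?_
    simp_rw [hXW]
    exact aemeasurable_timeChange (hW j) (hY j)
  obtain ⟨Z, hZm, hZω, hZt⟩ := exists_measurable_modification hXm T
  have hker := lintegral_ballKernel_modification hW hY hWi hYi hWY hXW hZt
  have hiff : (d : ℝ) < α / H ↔ H / α * d < 1 := by
    rw [lt_div_iff₀ hH, div_mul_eq_mul_div, div_lt_one hα, mul_comm]
  rw [hiff, ← lintegral_lintegral_rpow_neg_lt_top_iff hT]
  set ν : Measure ℝ := volume.restrict (Set.Icc 0 T) with hν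
  have hr : ∀ n : ℕ, 0 < 1 / ((n : ℝ) + 1) := fun n => Nat.one_div_pos_of_nat
  have hr0 := tendsto_one_div_add_atTop_nhds_zero_nat (𝕜 := ℝ)
  have hKm := fun r => measurable_lintegral_ballKernel (volume : Measure (Fin d → ℝ)) P hZm r
  constructor
  · rintro ⟨L, hL, hloc⟩
    have hex : ∀ᵐ ω ∂P, ∃ g : (Fin d → ℝ) → ℝ≥0∞, Measurable g ∧
        (ν.map fun t => Z (t, ω)) = volume.withDensity g ∧
        ∫⁻ y, g y ^ 2 = ∫⁻ y, ‖L ω y‖ₑ ^ 2 := by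
      filter_upwards [hloc, hZω] with ω h1 h2
      exact h1.exists_density h2 (hZm.comp measurable_prodMk_right)
    have hLint : ∫⁻ ω, ∫⁻ y, ‖L ω y‖ₑ ^ 2 ∂volume ∂P < ∞ := by
      have h1 := eLpNorm_lt_top_iff_lintegral_rpow_enorm_lt_top (by norm_num) (by norm_num) |>.1 hL.2
      rw [lintegral_prod _ (hL.1.enorm.pow_const _)] at h1
      simpa using h1
    have hbound : ∀ n : ℕ, ∫⁻ t, ∫⁻ s, ∫⁻ ω, ballKernel volume (1 / ((n : ℝ) + 1))
        (Z (t, ω)) (Z (s, ω)) ∂P ∂ν ∂ν ≤ ∫⁻ ω, ∫⁻ y, ‖L ω y‖ₑ ^ 2 ∂volume ∂P := by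
      intro n
      rw [← lintegral_ballAverage_map_sq volume P ν hZm]
      -- The densities may be chosen separately for each ω: the comparison of norms is pointwise in
      -- ω and needs no joint measurability.
      choose! g hg using fun ω (h : ∃ g : (Fin d → ℝ) → ℝ≥0∞, Measurable g ∧
        (ν.map fun t => Z (t, ω)) = volume.withDensity g ∧
        ∫⁻ y, g y ^ 2 = ∫⁻ y, ‖L ω y‖ₑ ^ 2) => h
      refine (lintegral_ballAverage_map_sq_le volume P ν (g := g) ?_ ?_ (hr n)).trans_eq
        (lintegral_congr_ae ?_)
      · filter_upwards [hex] with ω h using (hg ω h).1.aemeasurable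
      · filter_upwards [hex] with ω h using (hg ω h).2.1
      · filter_upwards [hex] with ω h using (hg ω h).2.2
    obtain ⟨D, hD0, hD⟩ := exists_le_liminf_prod_meanKernel hW hY hH hH1 hr hr0
    have hm : ∀ n : ℕ, Measurable fun t => ∫⁻ s, ∫⁻ ω, ballKernel volume (1 / ((n : ℝ) + 1))
        (Z (t, ω)) (Z (s, ω)) ∂P ∂ν := fun n => (hKm _).lintegral_prod_right'
    have hfatou : ∫⁻ t, ∫⁻ s, D * ENNReal.ofReal |t - s| ^ (-(H / α * d)) ∂ν ∂ν ≤
        ∫⁻ ω, ∫⁻ y, ‖L ω y‖ₑ ^ 2 ∂volume ∂P := by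
      -- Fatou is applied in t and then in s, using the lower bound off the diagonal.
      refine le_trans (lintegral_mono_ae ?_) ((lintegral_liminf_le (u := atTop) hm).trans
        (liminf_le_of_frequently_le' (Frequently.of_forall hbound)))
      filter_upwards [hker] with t ht
      refine le_trans (lintegral_mono_ae ?_)
        (lintegral_liminf_le (u := atTop) fun n => (hKm (1 / ((n : ℝ) + 1))).comp
          measurable_prodMk_left)
      filter_upwards [ht] with s hs
      rw [← hs.2.1]
      refine (hD _ _ hs.1).trans_eq ?_
      congr 1
      ext n
      exact (hs.2.2 _ (hr n)).symm
    have hq : Measurable fun p : ℝ × ℝ => ENNReal.ofReal |p.1 - p.2| ^ (-(H / α * d)) := by fun_prop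
    have hq1 : ∀ t : ℝ, Measurable fun s => ENNReal.ofReal |t - s| ^ (-(H / α * d)) :=
      fun t => hq.comp measurable_prodMk_left
    simp_rw [lintegral_const_mul D (hq1 _)] at hfatou
    rw [lintegral_const_mul D hq.lintegral_prod_right'] at hfatou
    exact ENNReal.lt_top_of_mul_ne_top_right (hfatou.trans_lt hLint).ne hD0
  · intro hJ
    obtain ⟨D, hDt, hD⟩ := exists_prod_meanKernel_le hW hY hH hH1
    have hbound : ∀ n : ℕ, ∫⁻ ω, ∫⁻ x, ballAverage volume (ν.map fun t => Z (t, ω))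
        (1 / ((n : ℝ) + 1)) x ^ 2 ∂volume ∂P ≤
        ∫⁻ t, ∫⁻ s, D * ENNReal.ofReal |t - s| ^ (-(H / α * d)) ∂ν ∂ν := by
      intro n
      rw [lintegral_ballAverage_map_sq volume P ν hZm]
      refine lintegral_mono_ae ?_
      filter_upwards [hker] with t ht
      refine lintegral_mono_ae ?_
      filter_upwards [ht] with s hs
      rw [hs.2.2 _ (hr n), ← hs.2.1]
      exact hD _ (hr n) _ _ hs.1
    have hfin : ∫⁻ t, ∫⁻ s, D * ENNReal.ofReal |t - s| ^ (-(H / α * d)) ∂ν ∂ν < ∞ := by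
      simp_rw [lintegral_const_mul' D _ hDt]
      exact ENNReal.mul_lt_top hDt.lt_top hJ
    obtain ⟨g, hgm, hgint, hg⟩ :=
      exists_density_of_ballAverage_bounded volume P ν hZm hr hr0 hfin.ne hbound
    refine ⟨fun ω y => (g (ω, WithLp.ofLp y)).toReal, ⟨?_, ?_⟩, ?_⟩
    · have hp : Measurable fun p : Ω × EuclideanSpace ℝ (Fin d) => (p.1, WithLp.ofLp p.2) :=
        measurable_fst.prodMk
          ((MeasurableEquiv.toLp 2 (Fin d → ℝ)).symm.measurable.comp measurable_snd)
      exact (hgm.comp hp).ennreal_toReal.aestronglyMeasurable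
    · have hp : Measurable fun p : Ω × EuclideanSpace ℝ (Fin d) => g (p.1, WithLp.ofLp p.2) ^ 2 :=
        (hgm.comp (measurable_fst.prodMk
          ((MeasurableEquiv.toLp 2 (Fin d → ℝ)).symm.measurable.comp measurable_snd))).pow_const 2
      rw [eLpNorm_lt_top_iff_lintegral_rpow_enorm_lt_top (by norm_num) (by norm_num)]
      refine lt_of_le_of_lt (b := ∫⁻ p : Ω × EuclideanSpace ℝ (Fin d),
        g (p.1, WithLp.ofLp p.2) ^ 2 ∂P.prod volume) (lintegral_mono fun p => ?_) ?_
      · simp only [ENNReal.toReal_ofNat, ENNReal.rpow_two]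
        gcongr
        rw [Real.enorm_of_nonneg ENNReal.toReal_nonneg]
        -- Where g is infinite `toReal` gives 0, so only an inequality holds pointwise.
        exact ENNReal.ofReal_toReal_le
      · rw [lintegral_prod _ hp.aemeasurable]
        refine lt_of_le_of_lt (le_of_eq (lintegral_congr fun ω => ?_)) (hgint.trans_lt hfin)
        exact (PiLp.volume_preserving_ofLp (Fin d)).lintegral_comp
          (f := fun x => g (ω, x) ^ 2) ((hgm.comp measurable_prodMk_left).pow_const 2)
    · filter_upwards [hg, hZω] with ω h1 h2
      exact isLocalTime_of_map_eq_withDensity h2 (hZm.comp measurable_prodMk_right)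
        (hgm.comp measurable_prodMk_left) h1

end Criterion

end AlphaTime

theorem theorem3p1 {Ω : Type*} [MeasurableSpace Ω] (P : Measure Ω) [IsProbabilityMeasure P]
    (d : ℕ) (α H : ℝ) (hα : 0 < α) (hα2 : α ≤ 2) (hH : 0 < H) (hH1 : H < 1)
    (X : ℝ≥0 → Ω → EuclideanSpace ℝ (Fin d))
    (hX : AlphaTime.IsAlphaTimeFractionalBrownianMotion α H X P)
    (T : ℝ) (hT : 0 < T) :
    (∃ L : Ω → EuclideanSpace ℝ (Fin d) → ℝ,
      MemLp (fun p : Ω × EuclideanSpace ℝ (Fin d) => L p.1 p.2) 2 (P.prod volume) ∧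
      ∀ᵐ ω ∂P, AlphaTime.IsLocalTime (fun t : ℝ => X t.toNNReal ω) (Set.Icc 0 T) (L ω)) ↔
    (d : ℝ) < α / H := hX.exists_localTime_iff hα hH hH1 hT
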